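/- Let $N\ge 0$ be an integer and $g\in\mathbb C$. Let $S_N$ act on rational functions in $x_1,\dots,x_N$ by permuting the variables, let $s_{ij}\in S_N$ be the transposition of $i$ and $j$, and put $$\nabla_i=\partial_{x_i}-\sum_{j\ne i}\frac{g}{x_i-x_j}\,s_{ij},\qquad M_{ij}=x_i\nabla_j-x_j\nabla_i\qquad(1\le i,j\le N),$$ $$S_{ij}=-g\,s_{ij}\ (i\neq j),\qquad S_{ii}=1+g\sum_{k\ne i}s_{ik}.$$ The Dunkl angular momenta algebra $H_g^{so(N)}$ is the algebra of operators over $\mathbb C$ generated by all $M_{ij}$ and by $\mathbb C S_N$. Let $V=\mathbb C^N$ with standard basis $e_1,\dots,e_N$, on which $S_N$ acts by $\sigma e_i=e_{\sigma(i)}$; in the smash product $T(\Lambda^2V)\#\mathbb C S_N$ write $M_{ij}$ for $e_i\wedge e_j$, and $S_{ij}$ for the element of $\mathbb C S_N$ given by the formula above. **(1)** The map that sends $M_{ij}\in T(\Lambda^2V)\#\mathbb C S_N$ to the operator $M_{ij}$ and $\sigma\in S_N$ to the operator $\sigma$ induces an isomorphism onto $H_g^{so(N)}$ of the quotient of $T(\Lambda^2V)\#\mathbb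 C S_N$ by the two-sided ideal generated by the relations $$[M_{ij},M_{kl}]=M_{il}S_{jk}+M_{jk}S_{il}-M_{ik}S_{lj}-M_{jl}S_{ik},$$ $$M_{ij}M_{kl}+M_{jk}M_{il}+M_{ki}M_{jl}=M_{ij}S_{kl}+M_{jk}S_{il}+M_{ki}S_{jl},$$ where $i,j,k,l$ run over all of $\{1,\dots,N\}$. **(2)** For every $g\in\mathbb C$ the monomials $$M_{i_1j_1}^{n_1}\cdots M_{i_kj_k}^{n_k}\,\sigma,\qquad k\ge0,\ n_s>0,\ i_s<j_s,\ \sigma\in S_N,$$ in which the pairs $(i_s,j_s)$ are strictly increasing in the lexicographic order and non-crossing (that is, $i_s<i_{s'}<j_s$ implies $j_{s'}\le j_s$), form a basis of $H_g^{so(N)}$ over $\mathbb C$. **(3)** Consequently the algebras $H_g^{so(N)}$ form a flat family of nonhomogeneous quadratic algebras over $\mathbb C S_N$ of Poincaré–Birkhoff–Witt type. That is: let $\Lambda^2V$ have degree $1$ and $S_N$ degree $0$, and give $H_g^{so(N)}$ the filtration $F_\bullet$ induced by the degree. The defining relations have degree at most $2$, and the natural map from the quotient of $T(\Lambda^2V)\#\mathbb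 C S_N$ by the quadratic parts of the relations to the associated graded algebra $\bigoplus_n F_n/F_{n-1}$ of $H_g^{so(N)}$ is an isomorphism in every degree. Moreover the algebra defined over the polynomial ring $\mathbb C[t]$ by the same generators and relations with $g$ replaced by $t$ is flat over $\mathbb C[t]$, and for each $g\in\mathbb C$ its quotient by $t-g$ is the algebra of (1) with parameter $g$, with $M_{ij}\mapsto M_{ij}$ and $\sigma\mapsto\sigma$. -/

import Mathlib

open scoped TensorProduct

/-! ### Quotients of a graded algebra by quadratic-linear relations -/

section Quadratic

variable {R T : Type*} [CommRing R] [Ring T] [Algebra R T]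

/-- The quotient of the algebra `T` by the two-sided ideal generated by the set `P`. -/
abbrev QuotBy (P : Set T) : Type _ := RingQuot (fun a b : T => a ∈ P ∧ b = 0)

/-- The quotient map `T → T / (P)`. -/
noncomputable def QuotBy.proj (R : Type*) {T : Type*} [CommRing R] [Ring T] [Algebra R T]
    (P : Set T) : T →ₐ[R] QuotBy P :=
  RingQuot.mkAlgHom R (fun a b : T => a ∈ P ∧ b = 0)

/-- For a grading `𝒯` of `T`, the sum of all components of degree `< n`; thus
`degreeLT 𝒯 (n + 1)` is the `n`-th term of the associated increasing filtration. -/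
def degreeLT (𝒯 : ℕ → Submodule R T) (n : ℕ) : Submodule R T :=
  ⨆ (m : ℕ) (_ : m < n), 𝒯 m

/-- The homogeneous quadratic parts of the elements of `P`. -/
def quadraticParts (𝒯 : ℕ → Submodule R T) (P : Set T) : Set T :=
  {r | r ∈ 𝒯 2 ∧ ∃ l ∈ degreeLT 𝒯 2, r + l ∈ P}

/-- The image in `T / (P)` of the elements of degree `< n`. -/
noncomputable def quotDegreeLT (𝒯 : ℕ → Submodule R T) (P : Set T) (n : ℕ) :
    Submodule R (QuotBy P) :=
  (degreeLT 𝒯 n).map (QuotBy.proj R P).toLinearMap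

/-- The `n`-th component `F_n / F_{n-1}` of the associated graded algebra of `T / (P)`. -/
abbrev grComponent (𝒯 : ℕ → Submodule R T) (P : Set T) (n : ℕ) : Type _ :=
  quotDegreeLT 𝒯 P (n + 1) ⧸
    (quotDegreeLT 𝒯 P n).comap (quotDegreeLT 𝒯 P (n + 1)).subtype

/-- The `n`-th component of the homogeneous quadratic algebra attached to `T / (P)`, that is
of the quotient of `T` by the quadratic parts of the relations. -/
noncomputable def quadComponent (𝒯 : ℕ → Submodule R T) (P : Set T) (n : ℕ) :
    Submodule R (QuotBy (quadraticParts 𝒯 P)) :=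
  (𝒯 n).map (QuotBy.proj R (quadraticParts 𝒯 P)).toLinearMap

theorem proj_mem_quadComponent (𝒯 : ℕ → Submodule R T) (P : Set T) (n : ℕ) {t : T}
    (ht : t ∈ 𝒯 n) : QuotBy.proj R (quadraticParts 𝒯 P) t ∈ quadComponent 𝒯 P n :=
  Submodule.mem_map_of_mem ht

theorem proj_mem_quotDegreeLT (𝒯 : ℕ → Submodule R T) (P : Set T) (n : ℕ) {t : T}
    (ht : t ∈ 𝒯 n) : QuotBy.proj R P t ∈ quotDegreeLT 𝒯 P (n + 1) :=
  Submodule.mem_map_of_mem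
    ((le_iSup₂_of_le (f := fun (m : ℕ) (_ : m < n + 1) => 𝒯 m) n n.lt_succ_self le_rfl) ht)

/-- `T / (P)` is a nonhomogeneous quadratic algebra of Poincaré–Birkhoff–Witt type: the
relations have degree at most two, and the natural map from the quotient of `T` by the quadratic
parts of the relations to the associated graded algebra of `T / (P)`, which sends the class of a
homogeneous element `t` of degree `n` to the class of `t` in `F_n / F_{n-1}`, is well defined and
bijective in each degree. (Such a map is multiplicative by its formula.) -/
structure IsPBWQuadratic (𝒯 : ℕ → Submodule R T) (P : Set T) : Prop where
  degree_le_two : ∀ r ∈ P, r ∈ degreeLT 𝒯 3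
  gr_equiv : ∀ n : ℕ, ∃ e : quadComponent 𝒯 P n ≃ₗ[R] grComponent 𝒯 P n,
    ∀ (t : T) (ht : t ∈ 𝒯 n),
      e ⟨QuotBy.proj R (quadraticParts 𝒯 P) t, proj_mem_quadComponent 𝒯 P n ht⟩ =
        Submodule.Quotient.mk ⟨QuotBy.proj R P t, proj_mem_quotDegreeLT 𝒯 P n ht⟩

end Quadratic

/-! ### The smash product of the tensor algebra of `Λ²V` with the symmetric group -/

section Smash

variable (N : ℕ) (R : Type*) [CommRing R]

/-- The tensor algebra `T(Λ²V)`, where `V = R^N`. -/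
abbrev TensorLambdaTwo : Type _ := TensorAlgebra R (⋀[R]^2 (Fin N → R))

/-- The action of a permutation on `V`: it sends the basis vector `e_i` to `e_{σ i}`. -/
def permBasis (σ : Equiv.Perm (Fin N)) : (Fin N → R) →ₗ[R] (Fin N → R) :=
  LinearMap.funLeft R R (σ⁻¹ : Equiv.Perm (Fin N))

theorem permBasis_single (σ : Equiv.Perm (Fin N)) (i : Fin N) :
    permBasis N R σ (Pi.single i 1) = Pi.single (σ i) 1 := by
  ext k
  simp only [permBasis, LinearMap.funLeft_apply, Pi.single_apply, Equiv.Perm.inv_eq_iff_eq]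

/-- The induced action of a permutation on `T(Λ²V)`. -/
noncomputable def permTensor (σ : Equiv.Perm (Fin N)) :
    TensorLambdaTwo N R →ₐ[R] TensorLambdaTwo N R :=
  TensorAlgebra.lift R (TensorAlgebra.ι R ∘ₗ exteriorPower.map 2 (permBasis N R σ))

theorem permTensor_one : permTensor N R 1 = AlgHom.id R _ := by
  have h : permBasis N R 1 = LinearMap.id := by ext; simp [permBasis]
  apply TensorAlgebra.hom_ext
  ext1
  simp [permTensor, h]

theorem permTensor_mul (σ τ : Equiv.Perm (Fin N)) :
    permTensor N R (σ * τ) = (permTensor N R σ).comp (permTensor N R τ) := by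
  have h : permBasis N R (σ * τ) = permBasis N R σ ∘ₗ permBasis N R τ := by
    ext; simp [permBasis, LinearMap.funLeft]
  apply TensorAlgebra.hom_ext
  apply LinearMap.ext
  intro x
  simp [permTensor, h, exteriorPower.map_comp]

noncomputable instance permTensorAction :
    MulSemiringAction (Equiv.Perm (Fin N)) (TensorLambdaTwo N R) where
  smul σ := permTensor N R σ
  one_smul x := DFunLike.congr_fun (permTensor_one N R) x
  mul_smul σ τ x := DFunLike.congr_fun (permTensor_mul N R σ τ) x
  smul_zero σ := map_zero (permTensor N R σ)
  smul_add σ := map_add (permTensor N R σ)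
  smul_one σ := map_one (permTensor N R σ)
  smul_mul σ := map_mul (permTensor N R σ)

instance permTensor_smulComm :
    SMulCommClass (Equiv.Perm (Fin N)) R (TensorLambdaTwo N R) where
  smul_comm σ r x := map_smul (permTensor N R σ) r x

/-- The smash product `T(Λ²V) # R S_N`: formal sums of terms `a σ`, multiplied by the rule
`(a σ)(b τ) = a σ(b) στ`. -/
abbrev Smash : Type _ := SkewMonoidAlgebra (TensorLambdaTwo N R) (Equiv.Perm (Fin N))

/-- The grading of the smash product: `Λ²V` has degree one and `S_N` has degree zero. -/
def smashGrading (n : ℕ) : Submodule R (Smash N R) where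
  carrier := {x | ∀ σ, x.coeff σ ∈
    (LinearMap.range (TensorAlgebra.ι R (M := ⋀[R]^2 (Fin N → R))) ^ n :
      Submodule R (TensorLambdaTwo N R))}
  add_mem' hx hy σ := by simpa using Submodule.add_mem _ (hx σ) (hy σ)
  zero_mem' σ := by simp
  smul_mem' r x hx σ := by simpa using Submodule.smul_mem _ r (hx σ)

variable {N} in
/-- The generator `M_{ij}`, that is `e_i ∧ e_j` times the identity permutation. -/
noncomputable def smashM (i j : Fin N) : Smash N R :=
  SkewMonoidAlgebra.single 1 (TensorAlgebra.ι R
    (exteriorPower.ιMulti R 2 ![(Pi.single i 1 : Fin N → R), Pi.single j 1]))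

variable {N} in
/-- A permutation as an element of the smash product. -/
noncomputable def smashPerm (σ : Equiv.Perm (Fin N)) : Smash N R :=
  SkewMonoidAlgebra.single σ 1

variable {N} {R} in
/-- `S_{ij} = -g s_{ij}` for `i ≠ j` and `S_{ii} = 1 + g ∑_{k ≠ i} s_{ik}`. -/
noncomputable def smashS (g : R) (i j : Fin N) : Smash N R :=
  if i = j then 1 + g • ∑ k ∈ Finset.univ.erase i, smashPerm R (Equiv.swap i k)
  else -(g • smashPerm R (Equiv.swap i j))

variable {N} {R} in
/-- The difference of the two sides of the commutation relation
`[M_{ij}, M_{kl}] = M_{il} S_{jk} + M_{jk} S_{il} - M_{ik} S_{lj} - M_{jl} S_{ik}`. -/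
noncomputable def commRel (g : R) (i j k l : Fin N) : Smash N R :=
  (smashM R i j * smashM R k l - smashM R k l * smashM R i j) -
    (smashM R i l * smashS g j k + smashM R j k * smashS g i l
      - smashM R i k * smashS g l j - smashM R j l * smashS g i k)

variable {N} {R} in
/-- The difference of the two sides of the crossing relation
`M_{ij} M_{kl} + M_{jk} M_{il} + M_{ki} M_{jl} = M_{ij} S_{kl} + M_{jk} S_{il} + M_{ki} S_{jl}`. -/
noncomputable def crossRel (g : R) (i j k l : Fin N) : Smash N R :=
  (smashM R i j * smashM R k l + smashM R j k * smashM R i l + smashM R k i * smashM R j l) -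
    (smashM R i j * smashS g k l + smashM R j k * smashS g i l + smashM R k i * smashS g j l)

variable {R} in
/-- All commutation relations and all crossing relations. -/
def dunklRelations (g : R) : Set (Smash N R) :=
  {r | ∃ i j k l : Fin N, r = commRel g i j k l ∨ r = crossRel g i j k l}

variable {R} in
/-- The quotient of `T(Λ²V) # R S_N` by the commutation and crossing relations with
parameter `g`. -/
abbrev DunklQuot (g : R) : Type _ := QuotBy (dunklRelations N g)

end Smash

/-! ### Dunkl angular momenta as operators on rational functions -/

section Operators

variable {N : ℕ}

/-- Rational functions in `x_1, …, x_N` over `ℂ`. -/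
abbrev RatFun (N : ℕ) : Type := FractionRing (MvPolynomial (Fin N) ℂ)

/-- The coordinate function `x_i`. -/
noncomputable def coordX (i : Fin N) : RatFun N := algebraMap (MvPolynomial (Fin N) ℂ) _ (.X i)

/-- The partial derivative `∂/∂x_i` of rational functions: the derivation that extends the
partial derivative of polynomials. -/
noncomputable def partialD (i : Fin N) : Derivation ℂ (RatFun N) (RatFun N) :=
  haveI : Algebra.FormallyEtale (MvPolynomial (Fin N) ℂ) (RatFun N) :=
    Algebra.FormallyEtale.of_isLocalization (nonZeroDivisors (MvPolynomial (Fin N) ℂ))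
  ((LinearMap.liftBaseChange (RatFun N)
      ((Algebra.linearMap (MvPolynomial (Fin N) ℂ) (RatFun N)).compDer
        (MvPolynomial.pderiv i)).liftKaehlerDifferential) ∘ₗ
    (KaehlerDifferential.tensorKaehlerEquivOfFormallyEtale ℂ
      (MvPolynomial (Fin N) ℂ) (RatFun N)).symm.toLinearMap).compDer
    (KaehlerDifferential.D ℂ (RatFun N))

theorem partialD_algebraMap (i : Fin N) (p : MvPolynomial (Fin N) ℂ) :
    partialD i (algebraMap _ (RatFun N) p) = algebraMap _ _ (MvPolynomial.pderiv i p) := by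
  have : Algebra.FormallyEtale (MvPolynomial (Fin N) ℂ) (RatFun N) :=
    Algebra.FormallyEtale.of_isLocalization (nonZeroDivisors (MvPolynomial (Fin N) ℂ))
  have h : (KaehlerDifferential.tensorKaehlerEquivOfFormallyEtale ℂ
      (MvPolynomial (Fin N) ℂ) (RatFun N)).symm
        (KaehlerDifferential.D ℂ (RatFun N) (algebraMap _ (RatFun N) p)) =
      1 ⊗ₜ KaehlerDifferential.D ℂ (MvPolynomial (Fin N) ℂ) p := by
    rw [LinearEquiv.symm_apply_eq]
    simp
  simp [partialD, h]

/-- The action of permutations on functions, with `σ x_i = x_{σ i}`; for a transposition it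
exchanges two arguments of the function. -/
noncomputable def permFun (σ : Equiv.Perm (Fin N)) : RatFun N ≃ₐ[ℂ] RatFun N :=
  IsFractionRing.algEquivOfAlgEquiv (MvPolynomial.renameEquiv ℂ σ)

/-- A permutation as an operator on functions. -/
noncomputable def permOp (σ : Equiv.Perm (Fin N)) : Module.End ℂ (RatFun N) :=
  (permFun σ).toLinearMap

/-- Multiplication by a rational function, as an operator. -/
noncomputable def mulOp (f : RatFun N) : Module.End ℂ (RatFun N) := LinearMap.mulLeft ℂ f

/-- The Dunkl operator `∇_i = ∂_i - ∑_{j ≠ i} g / (x_i - x_j) s_{ij}`. -/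
noncomputable def nablaOp (g : ℂ) (i : Fin N) : Module.End ℂ (RatFun N) :=
  (partialD i : RatFun N →ₗ[ℂ] RatFun N) -
    ∑ j ∈ Finset.univ.erase i,
      g • (mulOp (coordX i - coordX j)⁻¹ * permOp (Equiv.swap i j))

/-- The Dunkl angular momentum operator `M_{kl} = x_k ∇_l - x_l ∇_k`. -/
noncomputable def angularOp (g : ℂ) (k l : Fin N) : Module.End ℂ (RatFun N) :=
  mulOp (coordX k) * nablaOp g l - mulOp (coordX l) * nablaOp g k

/-- The Dunkl angular momenta algebra: the algebra of operators generated by the Dunkl angular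
momenta and by the permutations. -/
noncomputable def dunklAlgebra (N : ℕ) (g : ℂ) : Subalgebra ℂ (Module.End ℂ (RatFun N)) :=
  Algebra.adjoin ℂ
    ({D | ∃ k l : Fin N, D = angularOp g k l} ∪ {D | ∃ σ : Equiv.Perm (Fin N), D = permOp σ})

end Operators

/-! ### Non-crossing monomials -/

/-- `n i j` is the multiplicity of the semicircle joining `i` to `j`. Only pairs `i < j` occur,
and no two of the semicircles cross. -/
def IsNonCrossing {N : ℕ} (n : Fin N → Fin N → ℕ) : Prop :=
  (∀ i j, n i j ≠ 0 → i < j) ∧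
    ∀ i j i' j', n i j ≠ 0 → n i' j' ≠ 0 → i < i' → i' < j → j' ≤ j

/-- The product of the powers `M_{ij}^{n i j}`, the pairs `(i, j)` being taken in increasing
lexicographic order from left to right. -/
def orderedMonomial {N : ℕ} {A : Type*} [Monoid A] (M : Fin N → Fin N → A)
    (n : Fin N → Fin N → ℕ) : A :=
  ((List.finRange N).flatMap fun i => (List.finRange N).map fun j => M i j ^ n i j).prod

/-- The monomials `M_{i_1 j_1}^{n_1} ⋯ M_{i_k j_k}^{n_k} σ` without crossings, as operators. -/
noncomputable def nonCrossingMonomial {N : ℕ} (g : ℂ)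
    (a : {n : Fin N → Fin N → ℕ // IsNonCrossing n} × Equiv.Perm (Fin N)) :
    Module.End ℂ (RatFun N) :=
  orderedMonomial (angularOp g) a.1.1 * permOp a.2

/-! The presentation, the basis and the PBW property all follow from squeezing the non-crossing
monomials between an upper bound and a lower bound.

Upper bound: modulo terms of lower degree the relations say that the `M_{ij}` commute and satisfy
the Plücker relation `M_{ik} M_{jl} = M_{ij} M_{kl} + M_{jk} M_{il}`. For `i < j < k < l` this
replaces a crossing pair of arcs by the two ways of uncrossing it. A strictly concave weight of arc
lengths drops each time, so the process stops at non-crossing monomials (`smashWord_mul_mem_span`).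
They therefore span the abstract quotient, over any commutative ring (`span_proj_smashMonomial`).

Lower bound: the operators satisfy the relations. This is formal once the `x_i` commute, the Dunkl
operators commute (`nablaOp_comm`) and `[∇_i, x_j] = S_{ij}` (`angular_commutator`,
`angular_crossing`). The leading symbol of `M_{ij}` is the classical `x_i p_j - x_j p_i`, because
the reflection terms of `∇_i` have order zero. In a lexicographic order its leading term for `i < j`
is `p_i x_j`. The leading term of a monomial thus counts the arcs that start and end at each point,
and these counts determine a non-crossing configuration (`IsNonCrossing.ext_of_degrees`). Since the
operators `∂^α σ` are independent over the rational functions (`eq_zero_of_sum_normalOp_eq_zero`),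
independence of symbols lifts to independence of operators
(`linearIndependent_nonCrossingMonomial`).

A spanning family of the quotient is thus mapped to an independent family of operators, so the map
is injective and both families are bases. As straightening respects degrees, independence also
forces the associated graded algebra to have only the quadratic relations. Over `ℂ[t]` the same
monomials span, and they are independent because they are so at every value of `t`; the family is
free, hence flat. -/

/-! ### Universal property of the smash product. -/

section SmashLift

variable {N : ℕ} {R : Type*} [CommRing R] {A : Type*} [Ring A] [Algebra R A]

/-- The alternating bilinear map on `R^N` with prescribed values `m i j` on pairs of basis vectors. -/
def alternatingOfMatrix (m : Fin N → Fin N → A) (hself : ∀ i, m i i = 0)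
    (hanti : ∀ i j, m j i = -m i j) : (Fin N → R) [⋀^Fin 2]→ₗ[R] A where
  toFun v := ∑ i, ∑ j, (v 0 i * v 1 j) • m i j
  map_update_add' v k x y := by
    simp only [← Finset.sum_add_distrib]
    refine Finset.sum_congr rfl fun i _ => Finset.sum_congr rfl fun j _ => ?_
    fin_cases k <;> simp [add_mul, mul_add, add_smul]
  map_update_smul' v k c x := by
    simp only [Finset.smul_sum]
    refine Finset.sum_congr rfl fun i _ => Finset.sum_congr rfl fun j _ => ?_
    rw [smul_smul]
    congr 1
    have h : ∀ a b : Fin 2, a ≠ b → ∀ z : Fin N → R, Function.update v a z b = v b :=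
      fun a b hab z => Function.update_of_ne hab.symm _ _
    fin_cases k
    · change Function.update v 0 (c • x) 0 i * Function.update v 0 (c • x) 1 j =
        c * (Function.update v 0 x 0 i * Function.update v 0 x 1 j)
      rw [h 0 1 zero_ne_one, h 0 1 zero_ne_one, Function.update_self, Function.update_self,
        Pi.smul_apply, smul_eq_mul, mul_assoc]
    · change Function.update v 1 (c • x) 0 i * Function.update v 1 (c • x) 1 j =
        c * (Function.update v 1 x 0 i * Function.update v 1 x 1 j)
      rw [h 1 0 one_ne_zero, h 1 0 one_ne_zero, Function.update_self, Function.update_self,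
        Pi.smul_apply, smul_eq_mul, mul_left_comm]
  map_eq_zero_of_eq' v a b hv hab := by
    have h01 : v 0 = v 1 := by
      rcases Fin.exists_fin_two.1 ⟨a, rfl⟩ with rfl | rfl <;> rcases Fin.exists_fin_two.1 ⟨b, rfl⟩ with rfl | rfl
      exacts [absurd rfl hab, hv, hv.symm, absurd rfl hab]
    simp only [h01]
    rw [← Finset.sum_product']
    -- The terms at `(i, j)` and `(j, i)` cancel. The fixed points of this involution are diagonal
    -- terms; `hself` kills them, which antisymmetry alone does not do in characteristic two.
    refine Finset.sum_involution (fun p _ => (p.2, p.1)) ?_ ?_ ?_ ?_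
    · rintro ⟨i, j⟩ -
      simp [hanti i j, mul_comm]
    · rintro ⟨i, j⟩ - h e
      simp only [Prod.mk.injEq] at e
      obtain ⟨rfl, -⟩ := e
      simp [hself] at h
    · simp
    · simp

theorem alternatingOfMatrix_single (m : Fin N → Fin N → A) (hself : ∀ i, m i i = 0)
    (hanti : ∀ i j, m j i = -m i j) (i j : Fin N) :
    alternatingOfMatrix (R := R) m hself hanti ![Pi.single i 1, Pi.single j 1] = m i j := by
  change ∑ i', ∑ j', ((Pi.single i 1 : Fin N → R) i' * (Pi.single j 1 : Fin N → R) j') • m i' j' = _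
  rw [Finset.sum_eq_single i, Finset.sum_eq_single j] <;> simp +contextual [Pi.single_apply]

/-- The wedge product of two basis vectors. -/
noncomputable def basisWedge (R : Type*) [CommRing R] (i j : Fin N) : ⋀[R]^2 (Fin N → R) :=
  exteriorPower.ιMulti R 2 ![(Pi.single i 1 : Fin N → R), Pi.single j 1]

theorem smashM_eq (i j : Fin N) :
    smashM R i j = SkewMonoidAlgebra.single 1 (TensorAlgebra.ι R (basisWedge R i j)) := rfl

theorem basisWedge_self (i : Fin N) : basisWedge R i i = 0 :=
  (exteriorPower.ιMulti R 2).map_eq_zero_of_eq _ (i := 0) (j := 1) (by simp) (by simp)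

theorem basisWedge_swap (i j : Fin N) : basisWedge R j i = -basisWedge R i j := by
  rw [basisWedge, basisWedge, ← (exteriorPower.ιMulti R 2).map_swap _ (i := 0) (j := 1) (by simp)]
  congr 1
  ext a
  fin_cases a <;> simp

theorem span_basisWedge :
    Submodule.span R {w | ∃ i j : Fin N, i < j ∧ w = basisWedge R i j} = ⊤ := by
  refine top_unique ?_
  rw [← exteriorPower.ιMulti_span_of_span R 2 (Fin N → R)
    (s := Set.range fun i => (Pi.single i 1 : Fin N → R))
    (by simpa only [← Pi.basisFun_apply R (Fin N)] using (Pi.basisFun R (Fin N)).span_eq),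
    Submodule.span_le]
  rintro _ ⟨v, hv, rfl⟩
  obtain ⟨i, hi⟩ := hv (Set.mem_range_self 0)
  obtain ⟨j, hj⟩ := hv (Set.mem_range_self 1)
  have hv' : v = ![(Pi.single i 1 : Fin N → R), Pi.single j 1] := by
    ext a : 1
    fin_cases a
    exacts [hi.symm, hj.symm]
  change exteriorPower.ιMulti R 2 v ∈ _
  rw [hv']
  change basisWedge R i j ∈ _
  rcases lt_trichotomy i j with h | h | h
  · exact Submodule.subset_span ⟨i, j, h, rfl⟩
  · rw [h, basisWedge_self]
    exact Submodule.zero_mem _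
  · rw [basisWedge_swap]
    exact Submodule.neg_mem _ (Submodule.subset_span ⟨j, i, h, rfl⟩)

theorem exteriorPower_map_basisWedge (σ : Equiv.Perm (Fin N)) (i j : Fin N) :
    exteriorPower.map 2 (permBasis N R σ) (basisWedge R i j) = basisWedge R (σ i) (σ j) := by
  rw [basisWedge, exteriorPower.map_apply_ιMulti, basisWedge]
  congr 1
  ext a : 1
  fin_cases a <;> simp [permBasis_single]

theorem perm_smul_ι (σ : Equiv.Perm (Fin N)) (w : ⋀[R]^2 (Fin N → R)) :
    σ • TensorAlgebra.ι R w = TensorAlgebra.ι R (exteriorPower.map 2 (permBasis N R σ) w) := by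
  change permTensor N R σ _ = _
  simp [permTensor]

theorem smashM_self (i : Fin N) : smashM R i i = 0 := by
  rw [smashM_eq, basisWedge_self, map_zero, SkewMonoidAlgebra.single_zero]

theorem smashM_swap (i j : Fin N) : smashM R j i = -smashM R i j := by
  rw [smashM_eq, smashM_eq, basisWedge_swap, map_neg, SkewMonoidAlgebra.single_neg]

theorem smashPerm_one : smashPerm R (1 : Equiv.Perm (Fin N)) = 1 := rfl

theorem smashPerm_mul (σ τ : Equiv.Perm (Fin N)) :
    smashPerm R (σ * τ) = smashPerm R σ * smashPerm R τ := by
  simp [smashPerm]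

theorem smashPerm_mul_smashM (σ : Equiv.Perm (Fin N)) (i j : Fin N) :
    smashPerm R σ * smashM R i j = smashM R (σ i) (σ j) * smashPerm R σ := by
  simp [smashPerm, smashM_eq, perm_smul_ι, exteriorPower_map_basisWedge]

theorem single_eq_mul_smashPerm (σ : Equiv.Perm (Fin N)) (t : TensorLambdaTwo N R) :
    (SkewMonoidAlgebra.single σ t : Smash N R) =
      SkewMonoidAlgebra.single 1 t * smashPerm R σ := by
  simp [smashPerm]

/-- The universal property of the smash product `T(Λ²V) # R S_N`. -/
theorem exists_smash_lift (m : Fin N → Fin N → A) (ρ : Equiv.Perm (Fin N) →* A)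
    (hself : ∀ i, m i i = 0) (hanti : ∀ i j, m j i = -m i j)
    (hcomm : ∀ σ i j, ρ σ * m i j = m (σ i) (σ j) * ρ σ) :
    ∃ F : Smash N R →ₐ[R] A, (∀ i j, F (smashM R i j) = m i j) ∧
      ∀ σ, F (smashPerm R σ) = ρ σ := by
  let ℓ : ⋀[R]^2 (Fin N → R) →ₗ[R] A :=
    exteriorPower.alternatingMapLinearEquiv (alternatingOfMatrix m hself hanti)
  have hℓ : ∀ i j, ℓ (basisWedge R i j) = m i j := fun i j => by
    simp only [ℓ, basisWedge, exteriorPower.alternatingMapLinearEquiv_apply_ιMulti,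
      alternatingOfMatrix_single]
  let f : TensorLambdaTwo N R →ₐ[R] A := TensorAlgebra.lift R ℓ
  have hfι : ∀ w, f (TensorAlgebra.ι R w) = ℓ w := fun w => TensorAlgebra.lift_ι_apply _ _
  have hℓσ : ∀ σ w, ρ σ * ℓ w = ℓ (exteriorPower.map 2 (permBasis N R σ) w) * ρ σ := by
    intro σ w
    have hw : w ∈ Submodule.span R {w | ∃ i j : Fin N, i < j ∧ w = basisWedge R i j} := by
      rw [span_basisWedge]; trivial
    induction hw using Submodule.span_induction with
    | mem x hx =>
      obtain ⟨i, j, -, rfl⟩ := hx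
      rw [exteriorPower_map_basisWedge, hℓ, hℓ, hcomm]
    | zero => simp
    | add x y _ _ hx hy => rw [map_add, map_add, map_add, mul_add, add_mul, hx, hy]
    | smul c x _ hx =>
      rw [map_smul, map_smul, map_smul, mul_smul_comm, smul_mul_assoc, hx]
  -- To combine `f` and `ρ` on the smash product, the intertwining rule is needed for every tensor.
  -- It holds on `Λ²V` and is stable under sums and products.
  have key : ∀ (σ : Equiv.Perm (Fin N)) (t : TensorLambdaTwo N R),
      f (σ • t) * ρ σ = ρ σ * f t := by
    intro σ t
    induction t using TensorAlgebra.induction with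
    | algebraMap r =>
      rw [smul_algebraMap, AlgHom.commutes, Algebra.commutes]
    | ι w => rw [perm_smul_ι, hfι, hfι, hℓσ]
    | mul a b ha hb => rw [smul_mul', map_mul, map_mul, mul_assoc, hb, ← mul_assoc, ha, mul_assoc]
    | add a b ha hb => rw [smul_add, map_add, map_add, add_mul, mul_add, ha, hb]
  let F : Smash N R →ₐ[R] A := SkewMonoidAlgebra.liftNCAlgHom f ρ (fun {x y} => key y x)
  have hF : ∀ σ t, F (SkewMonoidAlgebra.single σ t) = f t * ρ σ := fun σ t =>
    SkewMonoidAlgebra.liftNC_single _ _ _ _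
  refine ⟨F, fun i j => ?_, fun σ => ?_⟩
  · rw [smashM_eq, hF, hfι, hℓ, map_one, mul_one]
  · rw [smashPerm, hF, map_one, one_mul]

end SmashLift

/-! ### Words in the generators and the grading of the smash product. -/

section SmashWords

variable {N : ℕ} {R : Type*} [CommRing R]

/-- The product of the generators `M_{ij}` along a list of pairs. -/
noncomputable def smashWord (R : Type*) [CommRing R] (L : List (Fin N × Fin N)) : Smash N R :=
  (L.map fun p => smashM R p.1 p.2).prod

theorem smashWord_nil : smashWord R ([] : List (Fin N × Fin N)) = 1 := rfl

theorem smashWord_cons (p : Fin N × Fin N) (L : List (Fin N × Fin N)) :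
    smashWord R (p :: L) = smashM R p.1 p.2 * smashWord R L := by
  simp [smashWord]

theorem smashWord_append (L L' : List (Fin N × Fin N)) :
    smashWord R (L ++ L') = smashWord R L * smashWord R L' := by
  simp [smashWord]

theorem smashPerm_mul_smashWord (σ : Equiv.Perm (Fin N)) (L : List (Fin N × Fin N)) :
    smashPerm R σ * smashWord R L =
      smashWord R (L.map fun p => (σ p.1, σ p.2)) * smashPerm R σ := by
  induction L with
  | nil => simp [smashWord_nil]
  | cons p L ih =>
    rw [smashWord_cons, List.map_cons, smashWord_cons, ← mul_assoc, smashPerm_mul_smashM,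
      mul_assoc, ih, mul_assoc]

theorem mul_mem_of_mem_span {A : Type*} [Ring A] [Algebra R A] {S T : Set A} {P : Submodule R A}
    (h : ∀ s ∈ S, ∀ t ∈ T, s * t ∈ P) {a b : A} (ha : a ∈ Submodule.span R S)
    (hb : b ∈ Submodule.span R T) : a * b ∈ P := by
  refine (Submodule.mul_le (P := P)).1 ?_ a ha b hb
  rw [Submodule.span_mul_span, Submodule.span_le]
  rintro _ ⟨s, hs, t, ht, rfl⟩
  exact h s hs t ht

theorem single_ι_mem_span (w : ⋀[R]^2 (Fin N → R)) :
    (SkewMonoidAlgebra.single 1 (TensorAlgebra.ι R w) : Smash N R) ∈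
      Submodule.span R {x | ∃ i j : Fin N, i < j ∧ x = smashM R i j} := by
  have hw : w ∈ Submodule.span R {w | ∃ i j : Fin N, i < j ∧ w = basisWedge R i j} := by
    rw [span_basisWedge]; trivial
  induction hw using Submodule.span_induction with
  | mem w hw =>
    obtain ⟨a, b, hab, rfl⟩ := hw
    exact Submodule.subset_span ⟨a, b, hab, rfl⟩
  | zero => rw [map_zero, SkewMonoidAlgebra.single_zero]; exact Submodule.zero_mem _
  | add y z _ _ hy hz =>
    rw [map_add, SkewMonoidAlgebra.single_add]
    exact Submodule.add_mem _ hy hz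
  | smul c y _ hy =>
    rw [map_smul, ← SkewMonoidAlgebra.smul_single]
    exact Submodule.smul_mem _ _ hy

theorem single_one_mem_span {n : ℕ} {t : TensorLambdaTwo N R}
    (ht : t ∈ (LinearMap.range (TensorAlgebra.ι R (M := ⋀[R]^2 (Fin N → R))) ^ n :
      Submodule R (TensorLambdaTwo N R))) :
    (SkewMonoidAlgebra.single 1 t : Smash N R) ∈
      Submodule.span R {x | ∃ L : List (Fin N × Fin N), L.length = n ∧ (∀ p ∈ L, p.1 < p.2) ∧
        x = smashWord R L} := by
  induction ht using Submodule.pow_induction_on_left' with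
  | algebraMap r =>
    rw [Algebra.algebraMap_eq_smul_one, ← SkewMonoidAlgebra.smul_single]
    exact Submodule.smul_mem _ _ (Submodule.subset_span ⟨[], by simp, by simp, rfl⟩)
  | add x y i _ _ hx hy =>
    rw [SkewMonoidAlgebra.single_add]
    exact Submodule.add_mem _ hx hy
  | mem_mul m hm i x _ hx =>
    obtain ⟨w, rfl⟩ := hm
    have hmul : (SkewMonoidAlgebra.single 1 (TensorAlgebra.ι R w * x) : Smash N R) =
        SkewMonoidAlgebra.single 1 (TensorAlgebra.ι R w) * SkewMonoidAlgebra.single 1 x := by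
      rw [SkewMonoidAlgebra.single_mul_single, one_smul, one_mul]
    rw [hmul]
    refine mul_mem_of_mem_span ?_ (single_ι_mem_span w) hx
    rintro _ ⟨a, b, hab, rfl⟩ _ ⟨L, hL, hL', rfl⟩
    refine Submodule.subset_span ⟨(a, b) :: L, by simp [hL], ?_, ?_⟩
    · simpa [hab] using hL'
    · rw [smashWord_cons]

/-- Words in the generators followed by a permutation span the homogeneous components. -/
theorem smashGrading_le_span (n : ℕ) :
    smashGrading N R n ≤ Submodule.span R {x | ∃ (L : List (Fin N × Fin N))
      (σ : Equiv.Perm (Fin N)), L.length = n ∧ (∀ p ∈ L, p.1 < p.2) ∧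
        x = smashWord R L * smashPerm R σ} := by
  intro x hx
  rw [← SkewMonoidAlgebra.sum_single x, SkewMonoidAlgebra.sum_def']
  refine Submodule.sum_mem _ fun σ _ => ?_
  rw [single_eq_mul_smashPerm]
  refine mul_mem_of_mem_span (T := {smashPerm R σ}) ?_
    (single_one_mem_span (n := n) (t := x.coeff σ) (hx σ)) (Submodule.mem_span_singleton_self _)
  rintro _ ⟨L, hL, hL', rfl⟩ _ rfl
  exact Submodule.subset_span ⟨L, σ, hL, hL', rfl⟩

theorem smashWord_eq_single (L : List (Fin N × Fin N)) :
    ∃ t ∈ (LinearMap.range (TensorAlgebra.ι R (M := ⋀[R]^2 (Fin N → R))) ^ L.length :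
      Submodule R (TensorLambdaTwo N R)),
      smashWord R L = SkewMonoidAlgebra.single 1 t := by
  induction L with
  | nil => exact ⟨1, by simp, rfl⟩
  | cons p L ih =>
    obtain ⟨t, ht, h⟩ := ih
    refine ⟨TensorAlgebra.ι R (basisWedge R p.1 p.2) * t, ?_, ?_⟩
    · rw [List.length_cons, pow_succ']
      exact Submodule.mul_mem_mul ⟨_, rfl⟩ ht
    · rw [smashWord_cons, h, smashM_eq]
      simp

theorem single_mem_smashGrading (σ : Equiv.Perm (Fin N)) {n : ℕ} {t : TensorLambdaTwo N R}
    (ht : t ∈ (LinearMap.range (TensorAlgebra.ι R (M := ⋀[R]^2 (Fin N → R))) ^ n :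
      Submodule R (TensorLambdaTwo N R))) :
    (SkewMonoidAlgebra.single σ t : Smash N R) ∈ smashGrading N R n := by
  intro τ
  rw [SkewMonoidAlgebra.coeff_single, Finsupp.single_apply]
  split_ifs
  · exact ht
  · exact Submodule.zero_mem _

theorem smashWord_mul_smashPerm_mem (L : List (Fin N × Fin N)) (σ : Equiv.Perm (Fin N)) :
    smashWord R L * smashPerm R σ ∈ smashGrading N R L.length := by
  obtain ⟨t, ht, h⟩ := smashWord_eq_single (R := R) L
  rw [h, ← single_eq_mul_smashPerm]
  exact single_mem_smashGrading σ ht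

theorem smashPerm_mem (σ : Equiv.Perm (Fin N)) : smashPerm R σ ∈ smashGrading N R 0 := by
  simpa [smashWord_nil] using smashWord_mul_smashPerm_mem (R := R) [] σ

theorem smashM_mem (i j : Fin N) : smashM R i j ∈ smashGrading N R 1 := by
  simpa [smashWord, smashPerm_one] using smashWord_mul_smashPerm_mem (R := R) [(i, j)] 1

theorem one_mem_smashGrading : (1 : Smash N R) ∈ smashGrading N R 0 :=
  smashPerm_mem 1

/-- It suffices to multiply words followed by permutations. Moving a permutation past a word
relabels its indices and keeps its length. -/
theorem mul_mem_smashGrading {p q : ℕ} {a b : Smash N R} (ha : a ∈ smashGrading N R p)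
    (hb : b ∈ smashGrading N R q) : a * b ∈ smashGrading N R (p + q) := by
  refine mul_mem_of_mem_span ?_ (smashGrading_le_span p ha) (smashGrading_le_span q hb)
  rintro _ ⟨L, σ, hL, -, rfl⟩ _ ⟨L', τ, hL', -, rfl⟩
  have : smashWord R L * smashPerm R σ * (smashWord R L' * smashPerm R τ) =
      smashWord R (L ++ L'.map fun p => (σ p.1, σ p.2)) * smashPerm R (σ * τ) := by
    rw [smashWord_append, smashPerm_mul, mul_assoc, ← mul_assoc (smashPerm R σ),
      smashPerm_mul_smashWord]
    simp only [mul_assoc]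
  rw [this]
  simpa [hL, hL'] using smashWord_mul_smashPerm_mem (R := R)
    (L ++ L'.map fun p => (σ p.1, σ p.2)) (σ * τ)

theorem mem_iSup_smashGrading (x : Smash N R) : x ∈ ⨆ n, smashGrading N R n := by
  classical
  rw [← SkewMonoidAlgebra.sum_single x, SkewMonoidAlgebra.sum_def']
  refine Submodule.sum_mem _ fun σ _ => ?_
  rw [← DirectSum.sum_support_decompose
    ((LinearMap.range (TensorAlgebra.ι R (M := ⋀[R]^2 (Fin N → R))) ^ ·) :
      ℕ → Submodule R (TensorLambdaTwo N R)) (x.coeff σ)]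
  have : ∀ (s : Finset ℕ) (f : ℕ → TensorLambdaTwo N R),
      (SkewMonoidAlgebra.single σ (∑ n ∈ s, f n) : Smash N R) =
        ∑ n ∈ s, SkewMonoidAlgebra.single σ (f n) := fun s f =>
    _root_.map_sum (SkewMonoidAlgebra.singleAddHom σ) f s
  rw [this]
  exact Submodule.sum_mem _ fun n _ =>
    Submodule.mem_iSup_of_mem n (single_mem_smashGrading σ (SetLike.coe_mem _))

/-- The projection of the smash product to its `n`-th homogeneous component. -/
noncomputable def smashProj (n : ℕ) : Smash N R →ₗ[R] Smash N R :=
  (SkewMonoidAlgebra.coeffLinearEquiv (S := R)).symm.toLinearMap ∘ₗ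
    Finsupp.mapRange.linearMap (GradedAlgebra.proj
      ((LinearMap.range (TensorAlgebra.ι R (M := ⋀[R]^2 (Fin N → R))) ^ ·) :
        ℕ → Submodule R (TensorLambdaTwo N R)) n) ∘ₗ
    (SkewMonoidAlgebra.coeffLinearEquiv (S := R)).toLinearMap

theorem coeff_smashProj (n : ℕ) (x : Smash N R) (σ : Equiv.Perm (Fin N)) :
    (smashProj n x).coeff σ = GradedAlgebra.proj
      ((LinearMap.range (TensorAlgebra.ι R (M := ⋀[R]^2 (Fin N → R))) ^ ·) :
        ℕ → Submodule R (TensorLambdaTwo N R)) n (x.coeff σ) := rfl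

theorem smashProj_of_mem {n : ℕ} {x : Smash N R} (hx : x ∈ smashGrading N R n) :
    smashProj n x = x := by
  ext σ
  rw [coeff_smashProj]
  exact DirectSum.decompose_of_mem_same _ (hx σ)

theorem smashProj_of_mem_ne {n m : ℕ} (h : m ≠ n) {x : Smash N R}
    (hx : x ∈ smashGrading N R m) : smashProj n x = 0 := by
  ext σ
  rw [coeff_smashProj]
  exact DirectSum.decompose_of_mem_ne _ (hx σ) h

end SmashWords

/-! ### Ideals generated by relations and by their quadratic parts. -/

section QuotBy

variable {R T : Type*} [CommRing R] [Ring T] [Algebra R T]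

theorem QuotBy.proj_surjective (P : Set T) : Function.Surjective (QuotBy.proj R P) :=
  RingQuot.mkAlgHom_surjective R _

theorem QuotBy.proj_eq_zero {P : Set T} {x : T} (hx : x ∈ P) : QuotBy.proj R P x = 0 := by
  rw [QuotBy.proj, RingQuot.mkAlgHom_rel R (s := fun a b : T => a ∈ P ∧ b = 0) (y := 0) ⟨hx, rfl⟩,
    map_zero]

/-- An element that vanishes in `T / (P)` lies in every two-sided ideal containing `P`. -/
theorem QuotBy.mem_of_proj_eq_zero {P : Set T} {J : Submodule R T} (hP : P ⊆ J)
    (hl : ∀ a, ∀ x ∈ J, a * x ∈ J) (hr : ∀ a, ∀ x ∈ J, x * a ∈ J) {x : T}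
    (hx : QuotBy.proj R P x = 0) : x ∈ J := by
  have hrel : ∀ a b : T, RingQuot.Rel (fun a b : T => a ∈ P ∧ b = 0) a b → a - b ∈ J := by
    intro a b h
    induction h with
    | of h => obtain ⟨h, rfl⟩ := h; simpa using hP h
    | add_left _ h => simpa using h
    | mul_left _ h => rw [← sub_mul]; exact hr _ _ h
    | mul_right _ h => rw [← mul_sub]; exact hl _ _ h
  have hgen : ∀ a b : T, Relation.EqvGen (RingQuot.Rel (fun a b : T => a ∈ P ∧ b = 0)) a b →
      a - b ∈ J := by
    intro a b h
    induction h with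
    | rel _ _ h => exact hrel _ _ h
    | refl => simp
    | symm _ _ _ h => simpa using J.neg_mem h
    | trans _ _ _ _ _ h₁ h₂ => simpa using J.add_mem h₁ h₂
  have h0 : QuotBy.proj R P x = QuotBy.proj R P 0 := by rw [hx, map_zero]
  have h1 : RingQuot.mkRingHom (fun a b : T => a ∈ P ∧ b = 0) x =
      RingQuot.mkRingHom (fun a b : T => a ∈ P ∧ b = 0) 0 := by
    rw [← RingQuot.mkAlgHom_coe R]
    exact h0
  rw [RingQuot.mkRingHom_def] at h1
  -- `RingQuot` is a `Quot`, so equality there is a finite chain of elementary rewritings, each of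
  -- which changes an element by a member of `J`.
  have h2 := hgen x 0 (Quot.eqvGen_exact (congrArg RingQuot.toQuot h1))
  simpa using h2

theorem le_degreeLT (𝒯 : ℕ → Submodule R T) {m n : ℕ} (h : m < n) : 𝒯 m ≤ degreeLT 𝒯 n :=
  le_iSup₂_of_le (f := fun (m : ℕ) (_ : m < n) => 𝒯 m) m h le_rfl

theorem degreeLT_succ (𝒯 : ℕ → Submodule R T) (n : ℕ) :
    degreeLT 𝒯 (n + 1) = degreeLT 𝒯 n ⊔ 𝒯 n := by
  apply le_antisymm
  · refine iSup₂_le fun m hm => ?_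
    rcases Nat.lt_succ_iff_lt_or_eq.1 hm with h | rfl
    · exact (le_degreeLT 𝒯 h).trans le_sup_left
    · exact le_sup_right
  · exact sup_le (iSup₂_le fun m hm => le_degreeLT 𝒯 (hm.trans n.lt_succ_self))
      (le_degreeLT 𝒯 n.lt_succ_self)

theorem quotDegreeLT_succ (𝒯 : ℕ → Submodule R T) (P : Set T) (n : ℕ) :
    quotDegreeLT 𝒯 P (n + 1) =
      quotDegreeLT 𝒯 P n ⊔ (𝒯 n).map (QuotBy.proj R P).toLinearMap := by
  rw [quotDegreeLT, degreeLT_succ, Submodule.map_sup]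
  rfl

/-- The part of degree `n` of the two-sided ideal generated by the quadratic parts of `P`. -/
noncomputable def quadraticIdealPart (𝒯 : ℕ → Submodule R T) (P : Set T) (n : ℕ) : Submodule R T :=
  Submodule.span R {x | ∃ p r : ℕ, p + 2 + r = n ∧ ∃ a ∈ 𝒯 p, ∃ q ∈ quadraticParts 𝒯 P,
    ∃ b ∈ 𝒯 r, x = a * q * b}

section Graded

variable {𝒯 : ℕ → Submodule R T} {P : Set T}
  (hmul : ∀ {p q : ℕ} {a b : T}, a ∈ 𝒯 p → b ∈ 𝒯 q → a * b ∈ 𝒯 (p + q))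

include hmul

theorem quadraticIdealPart_le (n : ℕ) : quadraticIdealPart 𝒯 P n ≤ 𝒯 n := by
  refine Submodule.span_le.2 ?_
  rintro _ ⟨p, r, rfl, a, ha, q, hq, b, hb, rfl⟩
  exact hmul (hmul ha hq.1) hb

theorem mul_mem_quadraticIdealPart {p n : ℕ} {a x : T} (ha : a ∈ 𝒯 p)
    (hx : x ∈ quadraticIdealPart 𝒯 P n) : a * x ∈ quadraticIdealPart 𝒯 P (p + n) := by
  induction hx using Submodule.span_induction with
  | mem x hx =>
    obtain ⟨p', r, rfl, a', ha', q, hq, b, hb, rfl⟩ := hx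
    exact Submodule.subset_span ⟨p + p', r, by ring, a * a', hmul ha ha', q, hq, b, hb,
      by simp only [mul_assoc]⟩
  | zero => simp
  | add x y _ _ hx hy => rw [mul_add]; exact Submodule.add_mem _ hx hy
  | smul c x _ hx => rw [mul_smul_comm]; exact Submodule.smul_mem _ _ hx

theorem mem_quadraticIdealPart_mul {p n : ℕ} {a x : T} (ha : a ∈ 𝒯 p)
    (hx : x ∈ quadraticIdealPart 𝒯 P n) : x * a ∈ quadraticIdealPart 𝒯 P (n + p) := by
  induction hx using Submodule.span_induction with
  | mem x hx =>
    obtain ⟨p', r, rfl, a', ha', q, hq, b, hb, rfl⟩ := hx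
    exact Submodule.subset_span ⟨p', r + p, by ring, a', ha', q, hq, b * a, hmul hb ha,
      by simp only [mul_assoc]⟩
  | zero => simp
  | add x y _ _ hx hy => rw [add_mul]; exact Submodule.add_mem _ hx hy
  | smul c x _ hx => rw [smul_mul_assoc]; exact Submodule.smul_mem _ _ hx

/-- In `T / (P)` a quadratic part `q` equals `-l` with `l` of degree below two, so `a * q * b` falls
into a smaller filtration step. -/
theorem proj_mem_of_mem_quadraticIdealPart {n : ℕ} {x : T}
    (hx : x ∈ quadraticIdealPart 𝒯 P n) : QuotBy.proj R P x ∈ quotDegreeLT 𝒯 P n := by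
  induction hx using Submodule.span_induction with
  | mem x hx =>
    obtain ⟨p, r, rfl, a, ha, q, ⟨-, l, hl, hql⟩, b, hb, rfl⟩ := hx
    have hle : degreeLT 𝒯 2 ≤ (degreeLT 𝒯 (p + 2 + r)).comap
        (LinearMap.mulRight R b ∘ₗ LinearMap.mulLeft R a) := by
      refine iSup₂_le fun m hm x hx => ?_
      exact le_degreeLT 𝒯 (show p + m + r < p + 2 + r by omega) (hmul (hmul ha hx) hb)
    have h1 : QuotBy.proj R P (a * q * b) = -QuotBy.proj R P (a * l * b) := by
      have := QuotBy.proj_eq_zero (R := R) hql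
      rw [map_add] at this
      rw [map_mul, map_mul, eq_neg_of_add_eq_zero_left this]
      simp
    rw [h1]
    exact Submodule.neg_mem _ (Submodule.mem_map_of_mem (hle hl))
  | zero => rw [map_zero]; exact Submodule.zero_mem _
  | add x y _ _ hx hy => rw [map_add]; exact Submodule.add_mem _ hx hy
  | smul c x _ hx => rw [map_smul]; exact Submodule.smul_mem _ _ hx

/-- The ideal generated by homogeneous elements is the sum of its homogeneous parts, and projecting
to degree `n` isolates the part wanted. Of the grading, only the projections `π` with these two
properties are used. -/
theorem mem_quadraticIdealPart_of_proj_eq_zero (hone : (1 : T) ∈ 𝒯 0)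
    (htop : ∀ x, x ∈ ⨆ n, 𝒯 n)
    (π : ℕ → T →ₗ[R] T) (hπ : ∀ n, ∀ x ∈ 𝒯 n, π n x = x)
    (hπ' : ∀ m n, m ≠ n → ∀ x ∈ 𝒯 m, π n x = 0) {n : ℕ} {t : T} (ht : t ∈ 𝒯 n)
    (h : QuotBy.proj R (quadraticParts 𝒯 P) t = 0) : t ∈ quadraticIdealPart 𝒯 P n := by
  have hJ : t ∈ ⨆ m, quadraticIdealPart 𝒯 P m := by
    refine QuotBy.mem_of_proj_eq_zero ?_ ?_ ?_ h
    · intro q hq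
      exact Submodule.mem_iSup_of_mem 2
        (Submodule.subset_span ⟨0, 0, rfl, 1, hone, q, hq, 1, hone, by simp⟩)
    · intro a x hx
      have ha : ⨆ p, 𝒯 p ≤ (⨆ m, quadraticIdealPart 𝒯 P m).comap (LinearMap.mulRight R x) := by
        refine iSup_le fun p a ha => ?_
        have : ⨆ m, quadraticIdealPart 𝒯 P m ≤
            (⨆ m, quadraticIdealPart 𝒯 P m).comap (LinearMap.mulLeft R a) :=
          iSup_le fun m y hy =>
            Submodule.mem_iSup_of_mem (p + m) (mul_mem_quadraticIdealPart hmul ha hy)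
        exact this hx
      exact ha (htop a)
    · intro a x hx
      have ha : ⨆ p, 𝒯 p ≤ (⨆ m, quadraticIdealPart 𝒯 P m).comap (LinearMap.mulLeft R x) := by
        refine iSup_le fun p a ha => ?_
        have : ⨆ m, quadraticIdealPart 𝒯 P m ≤
            (⨆ m, quadraticIdealPart 𝒯 P m).comap (LinearMap.mulRight R a) :=
          iSup_le fun m y hy =>
            Submodule.mem_iSup_of_mem (m + p) (mem_quadraticIdealPart_mul hmul ha hy)
        exact this hx
      exact ha (htop a)
  have hle : ⨆ m, quadraticIdealPart 𝒯 P m ≤ (quadraticIdealPart 𝒯 P n).comap (π n) := by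
    refine iSup_le fun m x hx => ?_
    have hx' := quadraticIdealPart_le hmul m hx
    rw [Submodule.mem_comap]
    rcases eq_or_ne m n with rfl | hmn
    · rwa [hπ m x hx']
    · rw [hπ' m n hmn x hx']
      exact Submodule.zero_mem _
  have := hle hJ
  rwa [Submodule.mem_comap, hπ n t ht] at this

end Graded

end QuotBy

/-! ### Straightening to non-crossing monomials. -/

section Straightening

variable {N : ℕ} {R : Type*} [CommRing R]

theorem smashS_mem (g : R) (i j : Fin N) : smashS g i j ∈ smashGrading N R 0 := by
  unfold smashS
  split_ifs
  · exact Submodule.add_mem _ one_mem_smashGrading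
      (Submodule.smul_mem _ _ (Submodule.sum_mem _ fun k _ => smashPerm_mem _))
  · exact Submodule.neg_mem _ (Submodule.smul_mem _ _ (smashPerm_mem _))

theorem smashM_mul_smashM_mem (i j k l : Fin N) :
    smashM R i j * smashM R k l ∈ smashGrading N R 2 :=
  mul_mem_smashGrading (smashM_mem i j) (smashM_mem k l)

theorem smashM_mul_smashS_mem (g : R) (i j k l : Fin N) :
    smashM R i j * smashS g k l ∈ smashGrading N R 1 :=
  mul_mem_smashGrading (smashM_mem i j) (smashS_mem g k l)

/-- Since `S_{ij}` has degree zero, the right-hand side of the relation is of degree one: to leading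
order the generators commute, whatever `g` is. -/
theorem comm_mem_quadraticParts (g : R) (i j k l : Fin N) :
    smashM R i j * smashM R k l - smashM R k l * smashM R i j ∈
      quadraticParts (smashGrading N R) (dunklRelations N g) := by
  refine ⟨Submodule.sub_mem _ (smashM_mul_smashM_mem _ _ _ _) (smashM_mul_smashM_mem _ _ _ _), _,
    le_degreeLT _ (show 1 < 2 by norm_num) (Submodule.neg_mem _ (Submodule.sub_mem _
      (Submodule.sub_mem _ (Submodule.add_mem _ (smashM_mul_smashS_mem g i l j k)
        (smashM_mul_smashS_mem g j k i l)) (smashM_mul_smashS_mem g i k l j))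
          (smashM_mul_smashS_mem g j l i k))), i, j, k, l, Or.inl ?_⟩
  rw [commRel, sub_eq_add_neg _ (_ - _ : Smash N R)]

theorem cross_mem_quadraticParts (g : R) (i j k l : Fin N) :
    smashM R i j * smashM R k l + smashM R j k * smashM R i l + smashM R k i * smashM R j l ∈
      quadraticParts (smashGrading N R) (dunklRelations N g) := by
  refine ⟨Submodule.add_mem _ (Submodule.add_mem _ (smashM_mul_smashM_mem _ _ _ _)
    (smashM_mul_smashM_mem _ _ _ _)) (smashM_mul_smashM_mem _ _ _ _), _,
    le_degreeLT _ (show 1 < 2 by norm_num) (Submodule.neg_mem _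
      (Submodule.add_mem _ (Submodule.add_mem _ (smashM_mul_smashS_mem g i j k l)
        (smashM_mul_smashS_mem g j k i l)) (smashM_mul_smashS_mem g k i j l))),
    i, j, k, l, Or.inr ?_⟩
  rw [crossRel, sub_eq_add_neg _ (_ + _ : Smash N R)]

theorem dunklRelations_le_degree_two (g : R) :
    ∀ r ∈ dunklRelations N g, r ∈ degreeLT (smashGrading N R) 3 := by
  have h2 := le_degreeLT (smashGrading N R) (show 2 < 3 by norm_num)
  have h1 := le_degreeLT (smashGrading N R) (show 1 < 3 by norm_num)
  rintro _ ⟨i, j, k, l, rfl | rfl⟩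
  · exact Submodule.sub_mem _ (h2 (Submodule.sub_mem _ (smashM_mul_smashM_mem _ _ _ _)
      (smashM_mul_smashM_mem _ _ _ _))) (h1 (Submodule.sub_mem _
      (Submodule.sub_mem _ (Submodule.add_mem _ (smashM_mul_smashS_mem _ _ _ _ _)
        (smashM_mul_smashS_mem _ _ _ _ _)) (smashM_mul_smashS_mem _ _ _ _ _)) (smashM_mul_smashS_mem _ _ _ _ _)))
  · exact Submodule.sub_mem _ (h2 (Submodule.add_mem _ (Submodule.add_mem _
      (smashM_mul_smashM_mem _ _ _ _) (smashM_mul_smashM_mem _ _ _ _)) (smashM_mul_smashM_mem _ _ _ _)))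
      (h1 (Submodule.add_mem _ (Submodule.add_mem _ (smashM_mul_smashS_mem _ _ _ _ _)
        (smashM_mul_smashS_mem _ _ _ _ _)) (smashM_mul_smashS_mem _ _ _ _ _)))

/-- The homogeneous part of degree `n` of the ideal of quadratic parts of the Dunkl relations. -/
noncomputable abbrev dunklQuadPart (g : R) (n : ℕ) : Submodule R (Smash N R) :=
  quadraticIdealPart (smashGrading N R) (dunklRelations N g) n

theorem mem_dunklQuadPart_two {g : R} {q : Smash N R}
    (hq : q ∈ quadraticParts (smashGrading N R) (dunklRelations N g)) :
    q ∈ dunklQuadPart g 2 :=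
  Submodule.subset_span ⟨0, 0, rfl, 1, one_mem_smashGrading, q, hq, 1, one_mem_smashGrading,
    by rw [one_mul, mul_one]⟩

theorem smashWord_mem (L : List (Fin N × Fin N)) : smashWord R L ∈ smashGrading N R L.length := by
  have := smashWord_mul_smashPerm_mem (R := R) L 1
  rwa [smashPerm_one, mul_one] at this

/-- A permutation of the factors is a chain of swaps of neighbours, each costing one commutator. -/
theorem smashWord_sub_mem_of_perm (g : R) {L L' : List (Fin N × Fin N)} (h : L.Perm L') :
    smashWord R L - smashWord R L' ∈ dunklQuadPart g L.length := by
  induction h with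
  | nil => rw [sub_self]; exact Submodule.zero_mem _
  | @cons p L L' _ ih =>
    rw [smashWord_cons, smashWord_cons, ← mul_sub, List.length_cons, add_comm]
    exact mul_mem_quadraticIdealPart mul_mem_smashGrading (smashM_mem _ _) ih
  | swap p q L =>
    rw [smashWord_cons, smashWord_cons, smashWord_cons, smashWord_cons, ← mul_assoc, ← mul_assoc,
      ← sub_mul, List.length_cons, List.length_cons, add_assoc, add_comm]
    exact mem_quadraticIdealPart_mul mul_mem_smashGrading (smashWord_mem L)
      (mem_dunklQuadPart_two (comm_mem_quadraticParts g _ _ _ _))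
  | @trans L₁ L₂ L₃ h₁ _ ih₁ ih₂ =>
    rw [← h₁.length_eq] at ih₂
    simpa using Submodule.add_mem _ ih₁ ih₂

theorem mul_smashPerm_mem_dunklQuadPart {g : R} {n : ℕ} {x : Smash N R}
    (hx : x ∈ dunklQuadPart g n) (σ : Equiv.Perm (Fin N)) :
    x * smashPerm R σ ∈ dunklQuadPart g n :=
  mem_quadraticIdealPart_mul (p := 0) mul_mem_smashGrading (smashPerm_mem σ) hx

theorem smash_neg_mul (a b : Smash N R) : -a * b = -(a * b) := neg_mul a b

/-- This is the leading part of the crossing relation with `M_{ki} = -M_{ik}`: the four endpoints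
are reconnected in the two other ways. -/
theorem smashWord_uncross (g : R) (i j k l : Fin N) (L : List (Fin N × Fin N)) :
    smashWord R ((i, k) :: (j, l) :: L) -
      (smashWord R ((i, j) :: (k, l) :: L) + smashWord R ((j, k) :: (i, l) :: L)) ∈
        dunklQuadPart g (L.length + 2) := by
  have h : smashWord R ((i, k) :: (j, l) :: L) -
      (smashWord R ((i, j) :: (k, l) :: L) + smashWord R ((j, k) :: (i, l) :: L)) =
      -((smashM R i j * smashM R k l + smashM R j k * smashM R i l + smashM R k i * smashM R j l)
        * smashWord R L) := by
    simp only [smashWord_cons]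
    rw [smashM_swap i k]
    simp only [add_mul, smash_neg_mul, mul_assoc]
    abel
  rw [h, add_comm]
  exact Submodule.neg_mem _ (mem_quadraticIdealPart_mul mul_mem_smashGrading (smashWord_mem L)
    (mem_dunklQuadPart_two (cross_mem_quadraticParts g i j k l)))

/-- The number of factors of an ordered monomial. -/
def monomialDegree (n : Fin N → Fin N → ℕ) : ℕ := ∑ i, ∑ j, n i j

/-- The list of pairs, in lexicographic order, with multiplicities `n`. -/
def sortedPairs (n : Fin N → Fin N → ℕ) : List (Fin N × Fin N) :=
  (List.finRange N).flatMap fun i => (List.finRange N).flatMap fun j => List.replicate (n i j) (i, j)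

theorem prod_flatMap_eq {α M : Type*} [Monoid M] (l : List α) (f : α → List M) :
    (l.flatMap f).prod = (l.map fun a => (f a).prod).prod := by
  induction l with
  | nil => rfl
  | cons a l ih => rw [List.flatMap_cons, List.prod_append, ih, List.map_cons, List.prod_cons]

theorem prod_map_sortedPairs {A : Type*} [Monoid A] (M : Fin N → Fin N → A)
    (n : Fin N → Fin N → ℕ) :
    ((sortedPairs n).map fun p => M p.1 p.2).prod = orderedMonomial M n := by
  simp only [sortedPairs, orderedMonomial, List.map_flatMap, prod_flatMap_eq,
    List.map_replicate, List.prod_replicate]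

theorem smashWord_sortedPairs (n : Fin N → Fin N → ℕ) :
    smashWord R (sortedPairs n) = orderedMonomial (smashM R) n :=
  prod_map_sortedPairs _ n

theorem length_sortedPairs (n : Fin N → Fin N → ℕ) :
    (sortedPairs n).length = monomialDegree n := by
  simp only [sortedPairs, List.length_flatMap, List.length_replicate, monomialDegree,
    Fin.sum_univ_def]

theorem perm_sortedPairs (L : List (Fin N × Fin N)) :
    L.Perm (sortedPairs fun i j => L.count (i, j)) := by
  rw [List.perm_iff_count]
  rintro ⟨a, b⟩
  simp only [sortedPairs, List.count_flatMap, Function.comp_def, List.count_replicate,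
    ← Fin.sum_univ_def]
  rw [Finset.sum_eq_single a, Finset.sum_eq_single b]
  · simp
  · intro j _ hj
    simp [hj]
  · simp
  · intro i _ hi
    simp [hi]
  · simp

/-- The non-crossing ordered monomials followed by a permutation, in the smash product. -/
noncomputable def smashMonomial (R : Type*) [CommRing R]
    (a : {n : Fin N → Fin N → ℕ // IsNonCrossing n} × Equiv.Perm (Fin N)) : Smash N R :=
  orderedMonomial (smashM R) a.1.1 * smashPerm R a.2

/-- The weight of a semicircle: a strictly concave function of its length. -/
def arcWeight (p : Fin N × Fin N) : ℕ := (p.2 - p.1 : ℕ) * (2 * N - (p.2 - p.1 : ℕ))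

/-- With gaps `u = j - i`, `v = k - j`, `w = l - k`, the two drops in weight are `2v(2N - u - v -
w)` and `2uw`. Both are positive because `u + v + w < N`. -/
theorem arcWeight_lt_of_crossing {i j k l : Fin N} (hij : i < j) (hjk : j < k) (hkl : k < l) :
    arcWeight (i, j) + arcWeight (k, l) < arcWeight (i, k) + arcWeight (j, l) ∧
      arcWeight (j, k) + arcWeight (i, l) < arcWeight (i, k) + arcWeight (j, l) := by
  have hl := l.2
  rw [Fin.lt_def] at hij hjk hkl
  obtain ⟨a, ha⟩ := Nat.exists_eq_add_of_lt hij
  obtain ⟨b, hb⟩ := Nat.exists_eq_add_of_lt hjk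
  obtain ⟨c, hc⟩ := Nat.exists_eq_add_of_lt hkl
  obtain ⟨d, hd⟩ := Nat.exists_eq_add_of_lt hl
  -- `e` and `f` turn the truncated subtractions into sums, which leaves polynomial inequalities in
  -- the gaps.
  have e : ∀ x y z : ℕ, y = x + z → y - x = z := by omega
  have f : ∀ z w : ℕ, N = z + w → 2 * N - z = z + 2 * w := by omega
  simp only [arcWeight]
  rw [e i j (a + 1) (by omega), e k l (c + 1) (by omega), e i k (a + b + 2) (by omega),
    e j l (b + c + 2) (by omega), e j k (b + 1) (by omega), e i l (a + b + c + 3) (by omega),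
    f (a + 1) (i + b + c + d + 3) (by omega), f (c + 1) (i + a + b + d + 3) (by omega),
    f (a + b + 2) (i + c + d + 2) (by omega), f (b + c + 2) (i + a + d + 2) (by omega),
    f (b + 1) (i + a + c + d + 3) (by omega), f (a + b + c + 3) (i + d + 1) (by omega)]
  constructor <;> nlinarith [Nat.zero_le (a * c), Nat.zero_le (a * b), Nat.zero_le (b * c),
    Nat.zero_le ((i : ℕ) * b), Nat.zero_le (d * b), Nat.zero_le (b * b)]

/-- Induction on the total weight of the arcs. A word with a crossing is rearranged to start with it
and replaced by two words of the same length and smaller weight; a word without crossings only has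
to be sorted. -/
theorem smashWord_mul_mem_span (g : R) (L : List (Fin N × Fin N)) (hL : ∀ p ∈ L, p.1 < p.2)
    (σ : Equiv.Perm (Fin N)) :
    smashWord R L * smashPerm R σ ∈
      Submodule.span R (smashMonomial R '' {a | monomialDegree a.1.1 = L.length}) ⊔
        dunklQuadPart g L.length := by
  induction hw : (L.map arcWeight).sum using Nat.strong_induction_on generalizing L with
  | _ w ih =>
    subst hw
    have hred : ∀ L' : List (Fin N × Fin N), L.Perm L' → smashWord R L' * smashPerm R σ ∈
        Submodule.span R (smashMonomial R '' {a | monomialDegree a.1.1 = L.length}) ⊔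
          dunklQuadPart g L.length →
        smashWord R L * smashPerm R σ ∈
          Submodule.span R (smashMonomial R '' {a | monomialDegree a.1.1 = L.length}) ⊔
            dunklQuadPart g L.length := by
      intro L' hp h
      rw [← sub_add_cancel (smashWord R L) (smashWord R L'), add_mul]
      exact Submodule.add_mem _ (Submodule.mem_sup_right
        (mul_smashPerm_mem_dunklQuadPart (smashWord_sub_mem_of_perm g hp) σ)) h
    by_cases hc : ∃ p ∈ L, ∃ q ∈ L, p.1 < q.1 ∧ q.1 < p.2 ∧ p.2 < q.2
    · obtain ⟨⟨i, k⟩, hp, ⟨j, l⟩, hq, hij, hjk, hkl⟩ := hc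
      simp only at hij hjk hkl
      obtain ⟨L', hL'⟩ : ∃ L', L.Perm ((i, k) :: (j, l) :: L') := by
        -- The two crossing arcs start at different points, so removing one leaves the other in the
        -- list.
        have hq' : (j, l) ∈ L.erase (i, k) :=
          (List.mem_erase_of_ne (by simp [hij.ne'])).2 hq
        exact ⟨_, (List.perm_cons_erase hp).trans ((List.perm_cons_erase hq').cons _)⟩
      have hlen : L.length = L'.length + 2 := hL'.length_eq
      have hwt : (L.map arcWeight).sum =
          arcWeight (i, k) + (arcWeight (j, l) + (L'.map arcWeight).sum) := by
        rw [(hL'.map arcWeight).sum_eq]; simp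
      have hlt := arcWeight_lt_of_crossing hij hjk hkl
      have hL'' : ∀ p ∈ L', p.1 < p.2 := fun p hp' => hL p (hL'.symm.subset (by simp [hp']))
      have hL1 : ∀ p ∈ (i, j) :: (k, l) :: L', p.1 < p.2 :=
        List.forall_mem_cons.2 ⟨hij, List.forall_mem_cons.2 ⟨hkl, hL''⟩⟩
      have hL2 : ∀ p ∈ (j, k) :: (i, l) :: L', p.1 < p.2 :=
        List.forall_mem_cons.2 ⟨hjk, List.forall_mem_cons.2 ⟨hij.trans (hjk.trans hkl), hL''⟩⟩
      have hw1 : (((i, j) :: (k, l) :: L').map arcWeight).sum < (L.map arcWeight).sum := by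
        rw [hwt, List.map_cons, List.sum_cons, List.map_cons, List.sum_cons]; omega
      have hw2 : (((j, k) :: (i, l) :: L').map arcWeight).sum < (L.map arcWeight).sum := by
        rw [hwt, List.map_cons, List.sum_cons, List.map_cons, List.sum_cons]; omega
      have h1 := ih _ hw1 _ hL1 rfl
      have h2 := ih _ hw2 _ hL2 rfl
      have hl1 : ((i, j) :: (k, l) :: L').length = L.length := hlen.symm
      have hl2 : ((j, k) :: (i, l) :: L').length = L.length := hlen.symm
      rw [hl1] at h1
      rw [hl2] at h2
      refine hred _ hL' ?_
      have h3 := mul_smashPerm_mem_dunklQuadPart (smashWord_uncross g i j k l L') σ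
      rw [← hlen] at h3
      rw [← sub_add_cancel (smashWord R ((i, k) :: (j, l) :: L')) (smashWord R ((i, j) :: (k, l) :: L')
        + smashWord R ((j, k) :: (i, l) :: L')), add_mul, add_mul (smashWord R _)]
      exact Submodule.add_mem _ (Submodule.mem_sup_right h3) (Submodule.add_mem _ h1 h2)
    · refine hred _ (perm_sortedPairs L) (Submodule.mem_sup_left (Submodule.subset_span ?_))
      refine ⟨⟨⟨fun i j => L.count (i, j), ?_, ?_⟩, σ⟩, ?_, ?_⟩
      · intro i j h
        exact hL (i, j) (List.count_pos_iff.1 (Nat.pos_of_ne_zero h))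
      · intro i j i' j' h h' h1 h2
        by_contra h3
        exact hc ⟨(i, j), List.count_pos_iff.1 (Nat.pos_of_ne_zero h), (i', j'),
          List.count_pos_iff.1 (Nat.pos_of_ne_zero h'), h1, h2, not_le.1 h3⟩
      · change monomialDegree _ = _
        rw [← length_sortedPairs, (perm_sortedPairs L).length_eq]
      · rw [smashMonomial, smashWord_sortedPairs]

/-- Straightening: modulo the quadratic parts of the relations, the homogeneous component of
degree `n` is spanned by non-crossing monomials. -/
theorem smashGrading_le_smashMonomial_sup (g : R) (n : ℕ) :
    smashGrading N R n ≤ Submodule.span R (smashMonomial R '' {a | monomialDegree a.1.1 = n}) ⊔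
      dunklQuadPart g n := by
  refine (smashGrading_le_span n).trans (Submodule.span_le.2 ?_)
  rintro _ ⟨L, σ, rfl, hL, rfl⟩
  exact smashWord_mul_mem_span g L hL σ

/-- Straightening is exact only modulo the quadratic ideal, whose image in the quotient has lower
degree, so the error is absorbed by induction. The degree bound on the monomials is what the PBW
property needs later. -/
theorem quotDegreeLT_le_span (g : R) (n : ℕ) :
    quotDegreeLT (smashGrading N R) (dunklRelations N g) n ≤
      Submodule.span R ((fun a => QuotBy.proj R (dunklRelations N g) (smashMonomial R a)) ''
        {a | monomialDegree a.1.1 < n}) := by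
  induction n with
  | zero => simp [quotDegreeLT, degreeLT]
  | succ n ih =>
    rw [quotDegreeLT_succ]
    refine sup_le (ih.trans (Submodule.span_mono (Set.image_mono fun a ha =>
      Nat.lt_succ_of_lt ha))) ?_
    refine (Submodule.map_mono (smashGrading_le_smashMonomial_sup g n)).trans ?_
    rw [Submodule.map_sup, Submodule.map_span]
    refine sup_le (Submodule.span_mono ?_) ?_
    · rintro _ ⟨_, ⟨a, ha, rfl⟩, rfl⟩
      exact ⟨a, Nat.lt_succ_of_le (le_of_eq ha), rfl⟩
    · rintro _ ⟨x, hx, rfl⟩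
      exact Submodule.span_mono (Set.image_mono fun a ha => Nat.lt_succ_of_lt ha)
        (ih (proj_mem_of_mem_quadraticIdealPart mul_mem_smashGrading hx))

theorem span_proj_smashMonomial (g : R) :
    Submodule.span R (Set.range fun a =>
      QuotBy.proj R (dunklRelations N g) (smashMonomial R a)) = ⊤ := by
  refine top_unique fun x _ => ?_
  obtain ⟨t, rfl⟩ := QuotBy.proj_surjective (R := R) _ x
  have : ⨆ n, smashGrading N R n ≤ (Submodule.span R (Set.range fun a =>
      QuotBy.proj R (dunklRelations N g) (smashMonomial R a))).comap
        (QuotBy.proj R (dunklRelations N g)).toLinearMap := by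
    refine iSup_le fun n y hy => ?_
    exact Submodule.span_mono (Set.image_subset_range _ _)
      (quotDegreeLT_le_span g (n + 1) (proj_mem_quotDegreeLT _ _ n hy))
  exact this (mem_iSup_smashGrading t)

end Straightening

/-! ### Angular momentum relations deduced from canonical commutation relations. -/

section AbstractDunkl

variable {ι A : Type*} [Ring A] (x D : ι → A) (S : ι → ι → A)

/-- Jacobi identity: with `S i j = [D i, x j]` the difference of the two sides is `[[D i, D k], x
j]`, which vanishes. -/
theorem bracket_symm_of_canonical (hDD : ∀ i j, D i * D j = D j * D i)
    (hDx : ∀ i j, D i * x j = x j * D i + S i j) (i j k : ι) :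
    S i j * D k - D k * S i j = S k j * D i - D i * S k j := by
  have e : ∀ i j, S i j = D i * x j - x j * D i := fun i j => by rw [hDx]; abel
  rw [e, e]
  linear_combination (norm := noncomm_ring) hDD i k * x j - x j * hDD i k

variable {x D S}

/-- Moving each `x` to the left of each `D` separates the classical product from a remainder linear
in `S`. -/
theorem angular_mul_angular (hDx : ∀ i j, D i * x j = x j * D i + S i j) (i j k l : ι) :
    (x i * D j - x j * D i) * (x k * D l - x l * D k) =
      (x i * x k * (D j * D l) - x i * x l * (D j * D k) - x j * x k * (D i * D l)
        + x j * x l * (D i * D k)) +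
      (x i * S j k * D l - x i * S j l * D k - x j * S i k * D l + x j * S i l * D k) := by
  linear_combination (norm := noncomm_ring) x i * hDx j k * D l - x i * hDx j l * D k
    - x j * hDx i k * D l + x j * hDx i l * D k

/-- The normally ordered parts cancel by the classical Plücker identity. In the remainder,
`bracket_symm_of_canonical` moves every `S` to the right of `D`. -/
theorem angular_crossing (hxx : ∀ i j, x i * x j = x j * x i)
    (hDD : ∀ i j, D i * D j = D j * D i) (hDx : ∀ i j, D i * x j = x j * D i + S i j)
    (hS : ∀ i j, S i j = S j i) (i j k l : ι) :
    (x i * D j - x j * D i) * (x k * D l - x l * D k) +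
      (x j * D k - x k * D j) * (x i * D l - x l * D i) +
      (x k * D i - x i * D k) * (x j * D l - x l * D j) =
    (x i * D j - x j * D i) * S k l + (x j * D k - x k * D j) * S i l +
      (x k * D i - x i * D k) * S j l := by
  have h := bracket_symm_of_canonical x D S hDD hDx
  rw [angular_mul_angular hDx, angular_mul_angular hDx, angular_mul_angular hDx, hS k i, hS k j,
    hS j i]
  linear_combination (norm := noncomm_ring) hxx i k * (D j * D l) - x i * x l * hDD j k
    - hxx j k * (D i * D l) + x j * x l * hDD i k - hxx i j * (D k * D l)
    + x k * x l * hDD j i + x i * h k l j + x j * h i l k + x k * h j l i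

theorem angular_commutator (hxx : ∀ i j, x i * x j = x j * x i)
    (hDD : ∀ i j, D i * D j = D j * D i) (hDx : ∀ i j, D i * x j = x j * D i + S i j)
    (hS : ∀ i j, S i j = S j i) (i j k l : ι) :
    (x i * D j - x j * D i) * (x k * D l - x l * D k) -
      (x k * D l - x l * D k) * (x i * D j - x j * D i) =
    (x i * D l - x l * D i) * S j k + (x j * D k - x k * D j) * S i l -
      (x i * D k - x k * D i) * S l j - (x j * D l - x l * D j) * S i k := by
  have h := bracket_symm_of_canonical x D S hDD hDx
  rw [angular_mul_angular hDx, angular_mul_angular hDx, hS l i, hS k j, hS l j, hS k i]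
  linear_combination (norm := noncomm_ring) hxx i k * (D j * D l) + x k * x i * hDD j l
    - hxx i l * (D j * D k) - x l * x i * hDD j k - hxx j k * (D i * D l) - x k * x j * hDD i l
    + hxx j l * (D i * D k) + x l * x j * hDD i k
    + x i * h j k l - x i * h j l k + x j * h i l k - x j * h i k l - x k * h i l j
    + x l * h i k j + x i * hS l k * D j - x i * D j * hS l k - x j * hS l k * D i
    + x j * D i * hS l k

end AbstractDunkl

/-! ### Ring identities for the commutativity of the Dunkl operators. -/

section RingIdentities

/-- The Jacobi identity read backwards: equality of the two brackets with `S` makes `[a, b]` commute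
with `x`. -/
theorem commutator_mul_of_canonical {A : Type*} [Ring A] {a b x s t : A} (h₁ : a * x = x * a + s)
    (h₂ : b * x = x * b + t) (h : a * t - t * a = b * s - s * b) :
    (a * b - b * a) * x = x * (a * b - b * a) := by
  linear_combination (norm := noncomm_ring) a * h₂ + h₁ * b - b * h₁ - h₂ * a + h

variable {A : Type*} [Ring A] [Algebra ℂ A]

theorem bracket_self_aux (g : ℂ) {a b s t : A} (h₁ : s * b = a * s) (h₂ : s * a = b * s)
    (h : b * t - t * b = b * s - s * b) :
    a * -(g • s) - -(g • s) * a = b * (1 + g • t) - (1 + g • t) * b := by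
  have e : b * (1 + g • t) - (1 + g • t) * b = g • (b * t - t * b) := by
    rw [mul_add, add_mul, mul_one, one_mul, mul_smul_comm, smul_mul_assoc, smul_sub]
    abel
  rw [e, h, mul_neg, neg_mul, mul_smul_comm, smul_mul_assoc, h₁, h₂, smul_sub]
  abel

theorem bracket_neg_smul_of_commute (g : ℂ) {a s : A} (h : a * s = s * a) :
    a * -(g • s) - -(g • s) * a = 0 := by
  rw [mul_neg, neg_mul, mul_smul_comm, smul_mul_assoc, h, sub_self]

theorem inv_sub_swap {K : Type*} [Field K] (a b : K) : (b - a)⁻¹ = -(a - b)⁻¹ := by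
  rw [← neg_sub a b, inv_neg]

end RingIdentities

/-! ### Dunkl operators: equivariance, canonical relations, commutativity. -/

section DunklOperators

variable {N : ℕ}

theorem coordX_injective : Function.Injective (coordX (N := N)) := fun _ _ h =>
  MvPolynomial.X_injective (IsFractionRing.injective (MvPolynomial (Fin N) ℂ) (RatFun N) h)

theorem coordX_sub_ne_zero {i j : Fin N} (h : i ≠ j) : coordX i - coordX j ≠ 0 :=
  sub_ne_zero.2 fun e => h (coordX_injective e)

theorem algebraMap_X (i : Fin N) :
    algebraMap (MvPolynomial (Fin N) ℂ) (RatFun N) (MvPolynomial.X i) = coordX i := rfl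

theorem derivation_ext_coordX {D₁ D₂ : Derivation ℂ (RatFun N) (RatFun N)}
    (h : ∀ i, D₁ (coordX i) = D₂ (coordX i)) : D₁ = D₂ := by
  have hp : ∀ p : MvPolynomial (Fin N) ℂ,
      D₁ (algebraMap _ (RatFun N) p) = D₂ (algebraMap _ (RatFun N) p) := by
    intro p
    induction p using MvPolynomial.induction_on with
    | C a =>
      have : algebraMap (MvPolynomial (Fin N) ℂ) (RatFun N) (MvPolynomial.C a) =
          algebraMap ℂ (RatFun N) a :=
        (IsScalarTower.algebraMap_apply ℂ (MvPolynomial (Fin N) ℂ) (RatFun N) a).symm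
      rw [this, Derivation.map_algebraMap, Derivation.map_algebraMap]
    | add p q hp hq => rw [map_add, map_add, map_add, hp, hq]
    | mul_X p i hp =>
      rw [map_mul, Derivation.leibniz, Derivation.leibniz, hp, algebraMap_X, h]
  ext f
  obtain ⟨p, q, -, rfl⟩ := IsFractionRing.div_surjective (A := MvPolynomial (Fin N) ℂ) f
  rw [Derivation.leibniz_div, Derivation.leibniz_div, hp, hp]

theorem partialD_coordX (i j : Fin N) : partialD i (coordX j) = if i = j then 1 else 0 := by
  rw [coordX, partialD_algebraMap, MvPolynomial.pderiv_X, Pi.single_apply]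
  rcases eq_or_ne i j with h | h
  · rw [if_pos h, if_pos h.symm, map_one]
  · rw [if_neg h, if_neg h.symm, map_zero]

theorem permFun_coordX (σ : Equiv.Perm (Fin N)) (i : Fin N) :
    permFun σ (coordX i) = coordX (σ i) := by
  rw [permFun, coordX, IsFractionRing.algEquivOfAlgEquiv_algebraMap]
  simp [coordX]

theorem algHom_ext_coordX {F G : RatFun N →ₐ[ℂ] RatFun N}
    (h : ∀ i, F (coordX i) = G (coordX i)) : F = G := by
  have hp : F.comp (IsScalarTower.toAlgHom ℂ (MvPolynomial (Fin N) ℂ) (RatFun N)) =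
      G.comp (IsScalarTower.toAlgHom ℂ (MvPolynomial (Fin N) ℂ) (RatFun N)) := by
    ext i
    exact h i
  refine AlgHom.ext fun f => ?_
  obtain ⟨p, q, -, rfl⟩ := IsFractionRing.div_surjective (A := MvPolynomial (Fin N) ℂ) f
  rw [map_div₀, map_div₀]
  exact congrArg₂ _ (DFunLike.congr_fun hp p) (DFunLike.congr_fun hp q)

theorem permFun_mul (σ τ : Equiv.Perm (Fin N)) (f : RatFun N) :
    permFun (σ * τ) f = permFun σ (permFun τ f) := by
  have : (permFun (σ * τ) : RatFun N →ₐ[ℂ] RatFun N) =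
      (permFun σ : RatFun N →ₐ[ℂ] RatFun N).comp (permFun τ : RatFun N →ₐ[ℂ] RatFun N) :=
    algHom_ext_coordX fun i => by simp [permFun_coordX]
  exact DFunLike.congr_fun this f

theorem permFun_one (f : RatFun N) : permFun 1 f = f := by
  have : ((permFun 1 : RatFun N ≃ₐ[ℂ] RatFun N) : RatFun N →ₐ[ℂ] RatFun N) = AlgHom.id ℂ _ :=
    algHom_ext_coordX fun i => by simp [permFun_coordX]
  exact DFunLike.congr_fun this f

theorem permOp_apply (σ : Equiv.Perm (Fin N)) (f : RatFun N) : permOp σ f = permFun σ f := rfl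

theorem mulOp_apply (f h : RatFun N) : mulOp f h = f * h := rfl

/-- Permutations as operators, as a monoid homomorphism. -/
noncomputable def permOpHom : Equiv.Perm (Fin N) →* Module.End ℂ (RatFun N) where
  toFun := permOp
  map_one' := LinearMap.ext permFun_one
  map_mul' σ τ := LinearMap.ext (permFun_mul σ τ)

theorem permOp_mul (σ τ : Equiv.Perm (Fin N)) : permOp (σ * τ) = permOp σ * permOp τ :=
  permOpHom.map_mul σ τ

theorem permOp_one : permOp (1 : Equiv.Perm (Fin N)) = 1 := permOpHom.map_one

theorem mulOp_mul (f h : RatFun N) : mulOp (f * h) = mulOp f * mulOp h :=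
  LinearMap.ext fun _ => mul_assoc _ _ _

theorem mulOp_comm (f h : RatFun N) : mulOp f * mulOp h = mulOp h * mulOp f := by
  rw [← mulOp_mul, mul_comm, mulOp_mul]

theorem permOp_mul_mulOp (σ : Equiv.Perm (Fin N)) (f : RatFun N) :
    permOp σ * mulOp f = mulOp (permFun σ f) * permOp σ :=
  LinearMap.ext fun h => map_mul (permFun σ) f h

/-- Conjugating a derivation by an automorphism gives a derivation, and a derivation of the rational
functions is determined by its values on the coordinates. -/
theorem permFun_partialD (σ : Equiv.Perm (Fin N)) (i : Fin N) (f : RatFun N) :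
    permFun σ (partialD i f) = partialD (σ i) (permFun σ f) := by
  let E : Derivation ℂ (RatFun N) (RatFun N) := Derivation.mk'
    ((permFun σ).toLinearMap ∘ₗ (partialD i : RatFun N →ₗ[ℂ] RatFun N) ∘ₗ
      (permFun σ⁻¹).toLinearMap) (fun a b => by
        have h : ∀ c, permFun σ (permFun σ⁻¹ c) = c := fun c => by
          rw [← permFun_mul, mul_inv_cancel, permFun_one]
        simp [h])
  have hE : E = partialD (σ i) := derivation_ext_coordX fun j => by
    change permFun σ (partialD i (permFun σ⁻¹ (coordX j))) = _
    rw [permFun_coordX, partialD_coordX, partialD_coordX]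
    simp only [Equiv.Perm.eq_inv_iff_eq]
    split_ifs <;> simp
  have h := DFunLike.congr_fun hE (permFun σ f)
  change permFun σ (partialD i (permFun σ⁻¹ (permFun σ f))) = _ at h
  rwa [← permFun_mul, inv_mul_cancel, permFun_one] at h

/-- The partial derivative as an operator. -/
noncomputable def partialOp (i : Fin N) : Module.End ℂ (RatFun N) :=
  (partialD i : RatFun N →ₗ[ℂ] RatFun N)

theorem partialOp_apply (i : Fin N) (f : RatFun N) : partialOp i f = partialD i f := rfl

theorem permOp_mul_partialOp (σ : Equiv.Perm (Fin N)) (i : Fin N) :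
    permOp σ * partialOp i = partialOp (σ i) * permOp σ :=
  LinearMap.ext (permFun_partialD σ i)

theorem partialOp_mul_mulOp (i : Fin N) (f : RatFun N) :
    partialOp i * mulOp f = mulOp f * partialOp i + mulOp (partialD i f) := by
  ext h
  simp [partialOp_apply, mulOp_apply, mul_comm]

theorem nablaOp_eq (g : ℂ) (i : Fin N) : nablaOp g i = partialOp i -
    ∑ j ∈ Finset.univ.erase i,
      g • (mulOp (coordX i - coordX j)⁻¹ * permOp (Equiv.swap i j)) := rfl

theorem permOp_mul_nablaOp (g : ℂ) (σ : Equiv.Perm (Fin N)) (i : Fin N) :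
    permOp σ * nablaOp g i = nablaOp g (σ i) * permOp σ := by
  rw [nablaOp_eq, nablaOp_eq, mul_sub, sub_mul, permOp_mul_partialOp, Finset.mul_sum,
    Finset.sum_mul]
  congr 1
  refine Finset.sum_equiv σ (by simp) fun j _ => ?_
  rw [mul_smul_comm, smul_mul_assoc, ← mul_assoc, permOp_mul_mulOp, mul_assoc, mul_assoc,
    ← permOp_mul, ← permOp_mul, map_inv₀, map_sub, permFun_coordX, permFun_coordX,
    Equiv.mul_swap_eq_swap_mul]

theorem permOp_mul_angularOp (g : ℂ) (σ : Equiv.Perm (Fin N)) (k l : Fin N) :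
    permOp σ * angularOp g k l = angularOp g (σ k) (σ l) * permOp σ := by
  simp only [angularOp, mul_sub, sub_mul]
  rw [← mul_assoc, ← mul_assoc, permOp_mul_mulOp, permOp_mul_mulOp, mul_assoc, mul_assoc,
    permOp_mul_nablaOp, permOp_mul_nablaOp, permFun_coordX, permFun_coordX, mul_assoc, mul_assoc]

/-- The operator `S_{ij}`. -/
noncomputable def permSOp (g : ℂ) (i j : Fin N) : Module.End ℂ (RatFun N) :=
  if i = j then 1 + g • ∑ k ∈ Finset.univ.erase i, permOp (Equiv.swap i k)
  else -(g • permOp (Equiv.swap i j))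

theorem permSOp_symm (g : ℂ) (i j : Fin N) : permSOp g i j = permSOp g j i := by
  rcases eq_or_ne i j with rfl | h
  · rfl
  · rw [permSOp, permSOp, if_neg h, if_neg h.symm, Equiv.swap_comm]

/-- The commutator of one reflection term with `x_j` contains the quotient `(x_{s j} - x_j) / (x_i -
x_k)`, where `s = s_{ik}`. It equals `-1`, `1` or `0` according as `j` is `i`, `k` or neither, so
the poles disappear. -/
theorem nablaOp_mul_coordX (g : ℂ) (i j : Fin N) :
    nablaOp g i * mulOp (coordX j) = mulOp (coordX j) * nablaOp g i + permSOp g i j := by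
  have hterm : ∀ k, k ≠ i → g • (mulOp (coordX i - coordX k)⁻¹ * permOp (Equiv.swap i k)) *
      mulOp (coordX j) - mulOp (coordX j) *
        (g • (mulOp (coordX i - coordX k)⁻¹ * permOp (Equiv.swap i k))) =
      if j = i then -(g • permOp (Equiv.swap i k)) else
        if j = k then g • permOp (Equiv.swap i k) else 0 := by
    intro k hk
    have h1 : g • (mulOp (coordX i - coordX k)⁻¹ * permOp (Equiv.swap i k)) *
      mulOp (coordX j) - mulOp (coordX j) *
        (g • (mulOp (coordX i - coordX k)⁻¹ * permOp (Equiv.swap i k))) =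
        g • (mulOp ((coordX i - coordX k)⁻¹ * (coordX (Equiv.swap i k j) - coordX j)) *
          permOp (Equiv.swap i k)) := by
      ext f
      simp only [LinearMap.sub_apply, Module.End.mul_apply, LinearMap.smul_apply, mulOp_apply,
        permOp_apply, map_mul, permFun_coordX]
      simp only [Algebra.smul_def]
      ring
    have hne := coordX_sub_ne_zero hk.symm
    rw [h1]
    split_ifs with hi hj
    · rw [hi, Equiv.swap_apply_left, show (coordX i - coordX k)⁻¹ * (coordX k - coordX i) = -1 by
        rw [← neg_sub (coordX i), mul_neg, inv_mul_cancel₀ hne]]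
      ext h
      simp [mulOp_apply]
    · rw [hj, Equiv.swap_apply_right, inv_mul_cancel₀ hne]
      ext h
      simp [mulOp_apply]
    · rw [Equiv.swap_apply_of_ne_of_ne hi hj, sub_self, mul_zero]
      ext h
      simp [mulOp_apply]
  have hsum : (∑ k ∈ Finset.univ.erase i,
      g • (mulOp (coordX i - coordX k)⁻¹ * permOp (Equiv.swap i k))) * mulOp (coordX j) -
      mulOp (coordX j) * (∑ k ∈ Finset.univ.erase i,
      g • (mulOp (coordX i - coordX k)⁻¹ * permOp (Equiv.swap i k))) =
      ∑ k ∈ Finset.univ.erase i, if j = i then -(g • permOp (Equiv.swap i k)) else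
        if j = k then g • permOp (Equiv.swap i k) else 0 := by
    rw [Finset.sum_mul, Finset.mul_sum, ← Finset.sum_sub_distrib]
    exact Finset.sum_congr rfl fun k hk => hterm k (Finset.ne_of_mem_erase hk)
  have hS : permSOp g i j = mulOp (partialD i (coordX j)) -
      ∑ k ∈ Finset.univ.erase i, (if j = i then -(g • permOp (Equiv.swap i k)) else
        if j = k then g • permOp (Equiv.swap i k) else 0) := by
    rw [permSOp, partialD_coordX]
    rcases eq_or_ne i j with rfl | hij
    · simp only [if_true, Finset.sum_neg_distrib, sub_neg_eq_add, Finset.smul_sum]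
      congr 1
      ext h
      simp [mulOp_apply]
    · rw [if_neg hij, if_neg hij]
      simp only [if_neg hij.symm]
      rw [Finset.sum_ite_eq, if_pos (by simp [hij.symm])]
      ext h
      simp [mulOp_apply]
  rw [hS, ← hsum, nablaOp_eq, sub_mul, mul_sub, partialOp_mul_mulOp]
  abel

/-- The function `∑_{j ≠ i} 1 / (x_i - x_j)`. -/
noncomputable def poleSum (i : Fin N) : RatFun N :=
  ∑ j ∈ Finset.univ.erase i, (coordX i - coordX j)⁻¹

theorem permFun_poleSum (σ : Equiv.Perm (Fin N)) (i : Fin N) :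
    permFun σ (poleSum i) = poleSum (σ i) := by
  rw [poleSum, poleSum, map_sum]
  refine Finset.sum_equiv σ (by simp) fun j _ => ?_
  rw [map_inv₀, map_sub, permFun_coordX, permFun_coordX]

theorem nablaOp_apply (g : ℂ) (i : Fin N) (f : RatFun N) : nablaOp g i f = partialD i f -
    ∑ j ∈ Finset.univ.erase i, g • ((coordX i - coordX j)⁻¹ * permFun (Equiv.swap i j) f) := by
  rw [nablaOp_eq, LinearMap.sub_apply, LinearMap.sum_apply]
  rfl

theorem nablaOp_one (g : ℂ) (i : Fin N) : nablaOp g i 1 = -(g • poleSum i) := by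
  rw [nablaOp_apply, poleSum, Finset.smul_sum]
  simp

/-- The transposition of `i` and `j` carries `poleSum j` to `poleSum i`; every other transposition
in the sum fixes `poleSum j`. -/
theorem nablaOp_poleSum (g : ℂ) {i j : Fin N} (h : i ≠ j) : nablaOp g i (poleSum j) =
    ((coordX i - coordX j)⁻¹) ^ 2 - g • (poleSum i * poleSum j +
      (coordX i - coordX j)⁻¹ * (poleSum i - poleSum j)) := by
  have h1 : partialD i (poleSum j) = ((coordX i - coordX j)⁻¹) ^ 2 := by
    rw [poleSum, map_sum, Finset.sum_eq_single i]
    · rw [Derivation.leibniz_inv, map_sub, partialD_coordX, partialD_coordX, if_neg h, if_pos rfl,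
        inv_sub_swap (coordX i) (coordX j)]
      simp
    · intro k hk hki
      rw [Derivation.leibniz_inv, map_sub, partialD_coordX, partialD_coordX, if_neg h,
        if_neg hki.symm]
      simp
    · simp [h]
  have h2 : ∑ k ∈ Finset.univ.erase i, (coordX i - coordX k)⁻¹ *
      permFun (Equiv.swap i k) (poleSum j) = poleSum i * poleSum j +
        (coordX i - coordX j)⁻¹ * (poleSum i - poleSum j) := by
    have hj : j ∈ Finset.univ.erase i := by simp [h.symm]
    have hpi : poleSum i = (coordX i - coordX j)⁻¹ +
        ∑ k ∈ (Finset.univ.erase i).erase j, (coordX i - coordX k)⁻¹ :=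
      (Finset.add_sum_erase _ _ hj).symm
    rw [← Finset.add_sum_erase _ _ hj, permFun_poleSum, Equiv.swap_apply_right]
    have : ∑ k ∈ (Finset.univ.erase i).erase j, (coordX i - coordX k)⁻¹ *
        permFun (Equiv.swap i k) (poleSum j) =
        (∑ k ∈ (Finset.univ.erase i).erase j, (coordX i - coordX k)⁻¹) * poleSum j := by
      rw [Finset.sum_mul]
      refine Finset.sum_congr rfl fun k hk => ?_
      rw [permFun_poleSum, Equiv.swap_apply_of_ne_of_ne h.symm (Finset.ne_of_mem_erase hk).symm]
    rw [this, show ∑ k ∈ (Finset.univ.erase i).erase j, (coordX i - coordX k)⁻¹ =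
      poleSum i - (coordX i - coordX j)⁻¹ by rw [hpi]; ring]
    ring
  rw [nablaOp_apply, h1, ← Finset.smul_sum, h2]

/-- The expression found in `nablaOp_poleSum` is symmetric in `i` and `j`. -/
theorem nablaOp_comm_one (g : ℂ) (i j : Fin N) :
    nablaOp g i (nablaOp g j 1) = nablaOp g j (nablaOp g i 1) := by
  rcases eq_or_ne i j with rfl | h
  · rfl
  · rw [nablaOp_one, nablaOp_one, map_neg, map_neg, map_smul, map_smul, nablaOp_poleSum g h,
      nablaOp_poleSum g h.symm, inv_sub_swap (coordX i) (coordX j)]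
    simp only [Algebra.smul_def]
    ring

theorem commute_swap_nablaOp (g : ℂ) {i j k : Fin N} (hi : k ≠ i) (hj : k ≠ j) :
    nablaOp g k * permOp (Equiv.swap i j) = permOp (Equiv.swap i j) * nablaOp g k := by
  rw [permOp_mul_nablaOp, Equiv.swap_apply_of_ne_of_ne hi hj]

theorem bracket_nablaOp_permSOp_self (g : ℂ) {i j : Fin N} (h : i ≠ j) :
    nablaOp g i * permSOp g j i - permSOp g j i * nablaOp g i =
      nablaOp g j * permSOp g i i - permSOp g i i * nablaOp g j := by
  rw [permSOp, permSOp, if_neg h.symm, if_pos rfl, Equiv.swap_comm j i]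
  refine bracket_self_aux g ?_ ?_ ?_
  · rw [permOp_mul_nablaOp, Equiv.swap_apply_right]
  · rw [permOp_mul_nablaOp, Equiv.swap_apply_left]
  · rw [Finset.mul_sum, Finset.sum_mul, ← Finset.sum_sub_distrib, Finset.sum_eq_single j]
    · intro k _ hk
      rw [commute_swap_nablaOp g h.symm hk.symm, sub_self]
    · intro hj
      exact absurd (Finset.mem_erase.2 ⟨h.symm, Finset.mem_univ j⟩) hj

/-- Checked directly on the permutations, since `bracket_symm_of_canonical` presupposes the
commutativity that this serves to prove. If `k` differs from `i` and `j`, both brackets vanish. -/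
theorem bracket_nablaOp_permSOp (g : ℂ) (i j k : Fin N) :
    nablaOp g i * permSOp g j k - permSOp g j k * nablaOp g i =
      nablaOp g j * permSOp g i k - permSOp g i k * nablaOp g j := by
  rcases eq_or_ne i j with rfl | hij
  · rfl
  rcases eq_or_ne k i with rfl | hki
  · exact bracket_nablaOp_permSOp_self g hij
  rcases eq_or_ne k j with rfl | hkj
  · exact (bracket_nablaOp_permSOp_self g hij.symm).symm
  · rw [permSOp, permSOp, if_neg hkj.symm, if_neg hki.symm,
      bracket_neg_smul_of_commute g (commute_swap_nablaOp g hij hki.symm),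
      bracket_neg_smul_of_commute g (commute_swap_nablaOp g hij.symm hkj.symm)]

/-- The Dunkl operators commute. -/
theorem nablaOp_comm (g : ℂ) (i j : Fin N) :
    nablaOp g i * nablaOp g j = nablaOp g j * nablaOp g i := by
  set D := nablaOp g i * nablaOp g j - nablaOp g j * nablaOp g i with hD
  have hx : ∀ k, D * mulOp (coordX k) = mulOp (coordX k) * D := fun k =>
    commutator_mul_of_canonical (nablaOp_mul_coordX g i k) (nablaOp_mul_coordX g j k)
      (bracket_nablaOp_permSOp g i j k)
  -- Commuting with all coordinates makes the commutator linear over polynomials. It kills `1`,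
  -- hence all polynomials, hence all fractions after multiplication by the denominator.
  have hp : ∀ (p : MvPolynomial (Fin N) ℂ) (f : RatFun N),
      D (algebraMap _ (RatFun N) p * f) = algebraMap _ (RatFun N) p * D f := by
    intro p
    induction p using MvPolynomial.induction_on with
    | C a =>
      intro f
      have : algebraMap (MvPolynomial (Fin N) ℂ) (RatFun N) (MvPolynomial.C a) =
          algebraMap ℂ (RatFun N) a :=
        (IsScalarTower.algebraMap_apply ℂ (MvPolynomial (Fin N) ℂ) (RatFun N) a).symm
      rw [this, ← Algebra.smul_def, ← Algebra.smul_def, map_smul]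
    | add p q hp hq => intro f; rw [map_add, add_mul, map_add, hp, hq, add_mul]
    | mul_X p k hp =>
      intro f
      rw [RingHom.map_mul, mul_assoc, hp, mul_assoc, algebraMap_X]
      exact congrArg _ (LinearMap.congr_fun (hx k) f)
  have h1 : D 1 = 0 := by
    rw [hD, LinearMap.sub_apply, Module.End.mul_apply, Module.End.mul_apply, nablaOp_comm_one,
      sub_self]
  have h0 : D = 0 := by
    ext f
    obtain ⟨p, q, hq, rfl⟩ := IsFractionRing.div_surjective (A := MvPolynomial (Fin N) ℂ) f
    have hq0 : algebraMap (MvPolynomial (Fin N) ℂ) (RatFun N) q ≠ 0 :=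
      IsFractionRing.to_map_ne_zero_of_mem_nonZeroDivisors hq
    have h2 := hp q (algebraMap _ (RatFun N) p / algebraMap _ (RatFun N) q)
    rw [mul_div_cancel₀ _ hq0, ← mul_one (algebraMap _ (RatFun N) p), hp, h1, mul_zero, mul_one]
      at h2
    exact (mul_eq_zero.1 h2.symm).resolve_left hq0
  exact sub_eq_zero.1 h0

theorem angularOp_self (g : ℂ) (i : Fin N) : angularOp g i i = 0 := sub_self _

theorem angularOp_swap (g : ℂ) (i j : Fin N) : angularOp g j i = -angularOp g i j :=
  (neg_sub _ _).symm

theorem angularOp_commutator (g : ℂ) (i j k l : Fin N) :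
    angularOp g i j * angularOp g k l - angularOp g k l * angularOp g i j =
      angularOp g i l * permSOp g j k + angularOp g j k * permSOp g i l -
        angularOp g i k * permSOp g l j - angularOp g j l * permSOp g i k :=
  angular_commutator (x := fun i => mulOp (coordX i)) (D := nablaOp g)
    (fun _ _ => mulOp_comm _ _) (nablaOp_comm g) (nablaOp_mul_coordX g) (permSOp_symm g) i j k l

theorem angularOp_crossing (g : ℂ) (i j k l : Fin N) :
    angularOp g i j * angularOp g k l + angularOp g j k * angularOp g i l +
      angularOp g k i * angularOp g j l =
      angularOp g i j * permSOp g k l + angularOp g j k * permSOp g i l +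
        angularOp g k i * permSOp g j l :=
  angular_crossing (x := fun i => mulOp (coordX i)) (D := nablaOp g)
    (fun _ _ => mulOp_comm _ _) (nablaOp_comm g) (nablaOp_mul_coordX g) (permSOp_symm g) i j k l

end DunklOperators

/-! ### Independence of non-crossing monomials in the classical angular momenta. -/

section NonCrossingPolynomials

variable {N : ℕ}

theorem orderedMonomial_eq_prod {A : Type*} [CommMonoid A] (M : Fin N → Fin N → A)
    (n : Fin N → Fin N → ℕ) : orderedMonomial M n = ∏ i, ∏ j, M i j ^ n i j := by
  rw [orderedMonomial, prod_flatMap_eq, Fin.prod_univ_def]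
  simp only [Fin.prod_univ_def]

/-- A non-crossing configuration is determined by the numbers of semicircles that begin and that
end at each point. -/
theorem IsNonCrossing.ext_of_degrees {n m : Fin N → Fin N → ℕ} (hn : IsNonCrossing n)
    (hm : IsNonCrossing m) (hout : ∀ i, ∑ j, n i j = ∑ j, m i j)
    (hin : ∀ j, ∑ i, n i j = ∑ i, m i j) : n = m := by
  have key : ∀ (d : ℕ) (i j : Fin N), (j : ℕ) - i = d → i < j → n i j = m i j := by
    intro d
    induction d using Nat.strong_induction_on with
    | _ d ih =>
      intro i j hd hij
      have hlt := Fin.lt_def.1 hij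
      -- `A` counts the arcs from `i` that end beyond `j`, and `B` the arcs to `j` that start before
      -- `i`. Two such arcs would cross, so one count is zero. Hence `q i j` is the smaller of the
      -- out-degree of `i` and the in-degree of `j`, each diminished by the arcs of smaller length,
      -- which are known by induction.
      have hsplit : ∀ q : Fin N → Fin N → ℕ, IsNonCrossing q →
          ∃ A B, (∑ k, q i k = ∑ k ∈ Finset.Ioo i j, q i k + q i j + A) ∧
            (∑ k, q k j = ∑ k ∈ Finset.Ioo i j, q k j + q i j + B) ∧ (A = 0 ∨ B = 0) := by
        intro q hq
        refine ⟨∑ k ∈ Finset.Ioi j, q i k, ∑ k ∈ Finset.Iio i, q k j, ?_, ?_, ?_⟩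
        · have h1 : (Finset.univ : Finset (Fin N)) =
              Finset.Iic i ∪ (Finset.Ioo i j ∪ {j} ∪ Finset.Ioi j) := by
            ext k
            simp only [Finset.mem_univ, Finset.mem_union, Finset.mem_Iic, Finset.mem_Ioo,
              Finset.mem_singleton, Finset.mem_Ioi, true_iff]
            omega
          rw [h1, Finset.sum_union, Finset.sum_union, Finset.sum_union, Finset.sum_singleton,
            Finset.sum_eq_zero (s := Finset.Iic i), zero_add]
          · intro k hk
            by_contra h
            exact absurd (hq.1 i k h) (not_lt.2 (Finset.mem_Iic.1 hk))
          · simp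
          · rw [Finset.disjoint_left]
            intro k hk hk'
            simp only [Finset.mem_union, Finset.mem_Ioo, Finset.mem_singleton,
              Finset.mem_Ioi] at hk hk'
            omega
          · rw [Finset.disjoint_left]
            intro k hk hk'
            simp only [Finset.mem_union, Finset.mem_Iic, Finset.mem_Ioo, Finset.mem_singleton,
              Finset.mem_Ioi] at hk hk'
            omega
        · have h1 : (Finset.univ : Finset (Fin N)) =
              Finset.Ici j ∪ (Finset.Ioo i j ∪ {i} ∪ Finset.Iio i) := by
            ext k
            simp only [Finset.mem_univ, Finset.mem_union, Finset.mem_Ici, Finset.mem_Ioo,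
              Finset.mem_singleton, Finset.mem_Iio, true_iff]
            omega
          rw [h1, Finset.sum_union, Finset.sum_union, Finset.sum_union, Finset.sum_singleton,
            Finset.sum_eq_zero (s := Finset.Ici j), zero_add]
          · intro k hk
            by_contra h
            exact absurd (hq.1 k j h) (not_lt.2 (Finset.mem_Ici.1 hk))
          · simp
          · rw [Finset.disjoint_left]
            intro k hk hk'
            simp only [Finset.mem_union, Finset.mem_Ioo, Finset.mem_singleton,
              Finset.mem_Iio] at hk hk'
            omega
          · rw [Finset.disjoint_left]
            intro k hk hk'
            simp only [Finset.mem_union, Finset.mem_Ici, Finset.mem_Ioo, Finset.mem_singleton,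
              Finset.mem_Iio] at hk hk'
            omega
        · by_contra h
          rw [not_or] at h
          obtain ⟨l, hl, hl'⟩ := Finset.exists_ne_zero_of_sum_ne_zero h.1
          obtain ⟨k, hk, hk'⟩ := Finset.exists_ne_zero_of_sum_ne_zero h.2
          exact absurd (hq.2 k j i l hk' hl' (Finset.mem_Iio.1 hk) hij)
            (not_le.2 (Finset.mem_Ioi.1 hl))
      obtain ⟨A, B, h1, h2, h3⟩ := hsplit n hn
      obtain ⟨A', B', h1', h2', h3'⟩ := hsplit m hm
      have e1 : ∑ k ∈ Finset.Ioo i j, n i k = ∑ k ∈ Finset.Ioo i j, m i k := by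
        refine Finset.sum_congr rfl fun k hk => ?_
        rw [Finset.mem_Ioo, Fin.lt_def, Fin.lt_def] at hk
        exact ih (k - i) (by omega) i k rfl hk.1
      have e2 : ∑ k ∈ Finset.Ioo i j, n k j = ∑ k ∈ Finset.Ioo i j, m k j := by
        refine Finset.sum_congr rfl fun k hk => ?_
        rw [Finset.mem_Ioo, Fin.lt_def, Fin.lt_def] at hk
        exact ih (j - k) (by omega) k j rfl hk.2
      have := hout i
      have := hin j
      omega
  ext i j
  rcases lt_or_ge i j with h | h
  · exact key _ i j rfl h
  · rw [show n i j = 0 from by_contra fun e => absurd (hn.1 i j e) (not_lt.2 h),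
      show m i j = 0 from by_contra fun e => absurd (hm.1 i j e) (not_lt.2 h)]

/-- In a linear combination the largest leading exponent occurs in one term only and cannot cancel.
-/
theorem linearIndependent_of_degree_injective {σ ι k : Type*} [Field k] (m : MonomialOrder σ)
    (f : ι → MvPolynomial σ k) (hf : ∀ a, f a ≠ 0)
    (hinj : Function.Injective fun a => m.degree (f a)) : LinearIndependent k f := by
  rw [linearIndependent_iff]
  intro l hl
  by_contra hne
  obtain ⟨a, ha, hmax⟩ := l.support.exists_max_image (fun a => m.toSyn (m.degree (f a)))
    (Finsupp.support_nonempty_iff.2 hne)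
  have h := congrArg (MvPolynomial.coeff (m.degree (f a))) hl
  rw [Finsupp.linearCombination_apply, Finsupp.sum, MvPolynomial.coeff_sum,
    Finset.sum_eq_single a] at h
  · rw [MvPolynomial.coeff_smul, MvPolynomial.coeff_zero, smul_eq_mul, mul_eq_zero,
      m.coeff_degree_eq_zero_iff] at h
    exact h.elim (Finsupp.mem_support_iff.1 ha) (hf a)
  · intro b hb hba
    rw [MvPolynomial.coeff_smul, m.coeff_eq_zero_of_lt, smul_zero]
    refine lt_of_le_of_ne (hmax b hb) fun e => hba (hinj ?_)
    exact m.toSyn.injective e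
  · intro h
    exact absurd ha h

/-- The classical angular momentum `x_i p_j - x_j p_i`, as a polynomial in the variables `p` and
`x`. -/
noncomputable def pluckerPoly (i j : Fin N) : MvPolynomial (Fin N ⊕ₗ Fin N) ℂ :=
  MvPolynomial.X (toLex (Sum.inr i)) * MvPolynomial.X (toLex (Sum.inl j)) -
    MvPolynomial.X (toLex (Sum.inr j)) * MvPolynomial.X (toLex (Sum.inl i))

theorem degree_X_mul_X {σ : Type*} (m : MonomialOrder σ) (a b : σ) :
    m.degree (MvPolynomial.X a * MvPolynomial.X b : MvPolynomial σ ℂ) =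
      Finsupp.single a 1 + Finsupp.single b 1 := by
  rw [m.degree_mul (MvPolynomial.X_ne_zero _) (MvPolynomial.X_ne_zero _), m.degree_X, m.degree_X]

/-- In this order the variables `p` (the left summand) outrank the `x`, and a smaller index outranks
a larger one. Already `p_i` against `p_j` decides that `x_j p_i` leads. -/
theorem degree_pluckerPoly {i j : Fin N} (h : i < j) :
    MonomialOrder.lex.degree (pluckerPoly i j) =
      Finsupp.single (toLex (Sum.inr j)) 1 + Finsupp.single (toLex (Sum.inl i)) 1 := by
  have hlt : MonomialOrder.lex.toSyn (MonomialOrder.lex.degree (MvPolynomial.X (toLex (Sum.inr i)) *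
      MvPolynomial.X (toLex (Sum.inl j)) : MvPolynomial (Fin N ⊕ₗ Fin N) ℂ)) <
      MonomialOrder.lex.toSyn (MonomialOrder.lex.degree (MvPolynomial.X (toLex (Sum.inr j)) *
      MvPolynomial.X (toLex (Sum.inl i)) : MvPolynomial (Fin N ⊕ₗ Fin N) ℂ)) := by
    rw [degree_X_mul_X, degree_X_mul_X, MonomialOrder.lex_lt_iff, Finsupp.Lex.lt_iff]
    refine ⟨toLex (Sum.inl i), ?_, ?_⟩
    · intro a ha
      obtain ⟨a, rfl⟩ := toLex.surjective a
      rcases a with k | k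
      · have hk : k < i := by simpa using ha
        simp [hk.ne', (hk.trans h).ne']
      · simp at ha
    · simp [h.ne']
  rw [pluckerPoly, ← neg_sub, MonomialOrder.degree_neg, MonomialOrder.degree_sub_of_lt hlt,
    degree_X_mul_X]

theorem pluckerPoly_ne_zero {i j : Fin N} (h : i < j) : pluckerPoly i j ≠ 0 := by
  intro e
  have := DFunLike.congr_fun (degree_pluckerPoly h) (toLex (Sum.inr j))
  rw [e, MonomialOrder.degree_zero] at this
  simp at this

theorem pluckerPoly_pow_ne_zero {n : Fin N → Fin N → ℕ} (hn : IsNonCrossing n) (i j : Fin N) :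
    pluckerPoly i j ^ n i j ≠ 0 := by
  rcases eq_or_ne (n i j) 0 with h | h
  · rw [h, pow_zero]; exact one_ne_zero
  · exact pow_ne_zero _ (pluckerPoly_ne_zero (hn.1 i j h))

theorem degree_pluckerMonomial {n : Fin N → Fin N → ℕ} (hn : IsNonCrossing n) :
    MonomialOrder.lex.degree (orderedMonomial pluckerPoly n) =
      ∑ i, ∑ j, n i j • (Finsupp.single (toLex (Sum.inr j)) 1 +
        Finsupp.single (toLex (Sum.inl i)) 1) := by
  rw [orderedMonomial_eq_prod, MonomialOrder.degree_prod
    (fun i _ => Finset.prod_ne_zero_iff.2 fun j _ => pluckerPoly_pow_ne_zero hn i j)]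
  refine Finset.sum_congr rfl fun i _ => ?_
  rw [MonomialOrder.degree_prod (fun j _ => pluckerPoly_pow_ne_zero hn i j)]
  refine Finset.sum_congr rfl fun j _ => ?_
  rcases eq_or_ne (n i j) 0 with h | h
  · rw [h, pow_zero, zero_smul, MonomialOrder.degree_one]
  · rw [MonomialOrder.degree_pow, degree_pluckerPoly (hn.1 i j h)]

/-- In the leading exponent, the entry at `p_i` is the number of arcs that start at `i` and the
entry at `x_j` the number that end at `j`. -/
theorem linearIndependent_pluckerMonomial :
    LinearIndependent ℂ fun n : {n : Fin N → Fin N → ℕ // IsNonCrossing n} =>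
      orderedMonomial pluckerPoly n.1 := by
  refine linearIndependent_of_degree_injective MonomialOrder.lex _ (fun n => ?_) ?_
  · rw [orderedMonomial_eq_prod]
    exact Finset.prod_ne_zero_iff.2 fun i _ => Finset.prod_ne_zero_iff.2 fun j _ =>
      pluckerPoly_pow_ne_zero n.2 i j
  · rintro ⟨n, hn⟩ ⟨m, hm⟩ h
    simp only [degree_pluckerMonomial hn, degree_pluckerMonomial hm] at h
    refine Subtype.ext (hn.ext_of_degrees hm (fun i => ?_) fun j => ?_)
    · have := DFunLike.congr_fun h (toLex (Sum.inl i))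
      simpa [Finsupp.finsetSum_apply, Finsupp.single_apply, Finset.sum_ite_eq] using this
    · have := DFunLike.congr_fun h (toLex (Sum.inr j))
      simpa [Finsupp.finsetSum_apply, Finsupp.single_apply, Finset.sum_ite_eq] using this

end NonCrossingPolynomials

/-! ### Normally ordered operators; independence of `∂^α σ` over the rational functions. -/

section Symbols

variable {N : ℕ}

/-- Evaluation of polynomials needs a commutative target; the subalgebra generated by the commuting
elements is one. -/
theorem exists_aeval_of_commute {ι A : Type*} [Ring A] [Algebra ℂ A] (a : ι → A)
    (h : ∀ i j, a i * a j = a j * a i) :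
    ∃ F : MvPolynomial ι ℂ →ₐ[ℂ] A, ∀ i, F (MvPolynomial.X i) = a i := by
  have := Algebra.isMulCommutative_adjoin ℂ (s := Set.range a)
    (by rintro _ ⟨i, rfl⟩ _ ⟨j, rfl⟩; exact h i j)
  let : CommRing (Algebra.adjoin ℂ (Set.range a)) :=
    { (inferInstance : Ring (Algebra.adjoin ℂ (Set.range a))) with
      mul_comm := this.is_comm.comm }
  let b : ι → Algebra.adjoin ℂ (Set.range a) := fun i => ⟨a i, Algebra.subset_adjoin ⟨i, rfl⟩⟩
  exact ⟨(Algebra.adjoin ℂ (Set.range a)).val.comp (MvPolynomial.aeval b), fun i => by simp [b]⟩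

theorem partialOp_comm (i j : Fin N) : partialOp i * partialOp j = partialOp j * partialOp i := by
  have h : ⁅partialD i, partialD (N := N) j⁆ = 0 := derivation_ext_coordX fun k => by
    rw [Derivation.commutator_apply, partialD_coordX, partialD_coordX]
    split_ifs <;> simp
  ext f
  have := DFunLike.congr_fun h f
  rw [Derivation.commutator_apply, Derivation.zero_apply, sub_eq_zero] at this
  exact this

/-- The differential operator with constant coefficients attached to a polynomial. -/
noncomputable def constDiffOp : MvPolynomial (Fin N) ℂ →ₐ[ℂ] Module.End ℂ (RatFun N) :=
  (exists_aeval_of_commute partialOp partialOp_comm).choose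

theorem constDiffOp_X (i : Fin N) : constDiffOp (MvPolynomial.X i) = partialOp i :=
  (exists_aeval_of_commute partialOp partialOp_comm).choose_spec i

theorem permOp_mul_constDiffOp (τ : Equiv.Perm (Fin N)) (p : MvPolynomial (Fin N) ℂ) :
    permOp τ * constDiffOp p = constDiffOp (MvPolynomial.rename τ p) * permOp τ := by
  induction p using MvPolynomial.induction_on with
  | C a =>
    rw [← MvPolynomial.algebraMap_eq, AlgHom.commutes, AlgHom.commutes, AlgHom.commutes,
      Algebra.commutes]
  | add p q hp hq => rw [map_add, map_add, map_add, mul_add, add_mul, hp, hq]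
  | mul_X p i hp =>
    rw [map_mul, map_mul, map_mul, ← mul_assoc, hp, mul_assoc, constDiffOp_X,
      permOp_mul_partialOp, MvPolynomial.rename_X, constDiffOp_X, mul_assoc]

theorem constDiffOp_mul_coordX (p : MvPolynomial (Fin N) ℂ) (i : Fin N) :
    constDiffOp p * mulOp (coordX i) =
      mulOp (coordX i) * constDiffOp p + constDiffOp (MvPolynomial.pderiv i p) := by
  induction p using MvPolynomial.induction_on with
  | C a =>
    rw [MvPolynomial.pderiv_C, map_zero, add_zero, ← MvPolynomial.algebraMap_eq,
      AlgHom.commutes, Algebra.commutes]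
  | add p q hp hq =>
    rw [map_add, map_add, map_add, mul_add, add_mul, hp, hq]
    abel
  | mul_X p k hp =>
    have h1 : partialOp k * mulOp (coordX i) =
        mulOp (coordX i) * partialOp k + constDiffOp (MvPolynomial.pderiv i (MvPolynomial.X k)) := by
      rw [partialOp_mul_mulOp, partialD_coordX, MvPolynomial.pderiv_X, Pi.single_apply]
      congr 1
      split_ifs
      · rw [map_one]
        exact LinearMap.ext fun f => one_mul f
      · rw [map_zero]
        exact LinearMap.ext fun f => zero_mul f
    rw [map_mul, mul_assoc, constDiffOp_X, h1, mul_add, ← mul_assoc, hp, Derivation.leibniz,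
      map_add, smul_eq_mul, smul_eq_mul, map_mul, map_mul, constDiffOp_X, add_mul, mul_assoc,
      ← constDiffOp_X k, ← map_mul constDiffOp (MvPolynomial.X k), mul_comm (MvPolynomial.X k),
      map_mul constDiffOp]
    abel

theorem ratFun_smul_eq (f : RatFun N) (T : Module.End ℂ (RatFun N)) : f • T = mulOp f * T := rfl

theorem ratFun_smul_mul (f : RatFun N) (S T : Module.End ℂ (RatFun N)) :
    f • S * T = f • (S * T) := rfl

theorem partialOp_mul_smul (i : Fin N) (f : RatFun N) (T : Module.End ℂ (RatFun N)) :
    partialOp i * (f • T) = f • (partialOp i * T) + partialD i f • T := by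
  rw [ratFun_smul_eq, ← mul_assoc, partialOp_mul_mulOp, add_mul, mul_assoc]
  rfl

theorem permOp_mul_smul (τ : Equiv.Perm (Fin N)) (f : RatFun N) (T : Module.End ℂ (RatFun N)) :
    permOp τ * (f • T) = permFun τ f • (permOp τ * T) := by
  rw [ratFun_smul_eq, ← mul_assoc, permOp_mul_mulOp, mul_assoc]
  rfl

/-- The normally ordered differential operator attached to a polynomial in the symbols of the
partial derivatives with coefficients in the rational functions. -/
noncomputable def normalOp : MvPolynomial (Fin N) (RatFun N) →ₗ[RatFun N] Module.End ℂ (RatFun N) :=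
  (MvPolynomial.basisMonomials (Fin N) (RatFun N)).constr (RatFun N)
    fun α => constDiffOp (MvPolynomial.monomial α 1)

theorem normalOp_monomial (α : Fin N →₀ ℕ) (c : RatFun N) :
    normalOp (MvPolynomial.monomial α c) = c • constDiffOp (MvPolynomial.monomial α 1) := by
  have h : MvPolynomial.monomial α c = c • MvPolynomial.basisMonomials (Fin N) (RatFun N) α := by
    rw [MvPolynomial.coe_basisMonomials, MvPolynomial.smul_monomial, smul_eq_mul, mul_one]
  rw [h, map_smul, normalOp, Module.Basis.constr_basis]

theorem normalOp_induction {P : MvPolynomial (Fin N) (RatFun N) → Prop}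
    (φ) (hm : ∀ α c, P (MvPolynomial.monomial α c))
    (ha : ∀ φ ψ, P φ → P ψ → P (φ + ψ)) : P φ :=
  MvPolynomial.monomial_add_induction_on φ (fun c => hm 0 c)
    fun α c _ _ _ h => ha _ _ (hm α c) h

/-- The commutator with `x_i` differentiates the symbol with respect to `p_i`. This makes the symbol
recoverable from the operator. -/
theorem normalOp_mul_coordX (φ : MvPolynomial (Fin N) (RatFun N)) (i : Fin N) :
    normalOp φ * mulOp (coordX i) =
      coordX i • normalOp φ + normalOp (MvPolynomial.pderiv i φ) := by
  induction φ using normalOp_induction with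
  | hm α c =>
    rw [MvPolynomial.pderiv_monomial, normalOp_monomial, normalOp_monomial, ratFun_smul_mul,
      constDiffOp_mul_coordX, MvPolynomial.pderiv_monomial, smul_add, ← ratFun_smul_eq,
      smul_comm (coordX i) c]
    congr 1
    rw [one_mul, mul_smul]
    congr 1
    have : (MvPolynomial.monomial (α - Finsupp.single i 1) ((α i : ℕ) : ℂ)) =
        ((α i : ℕ) : ℂ) • MvPolynomial.monomial (α - Finsupp.single i 1) 1 := by
      rw [MvPolynomial.smul_monomial, smul_eq_mul, mul_one]
    rw [this, map_smul, Nat.cast_smul_eq_nsmul, Nat.cast_smul_eq_nsmul]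
  | ha φ ψ hφ hψ =>
    rw [map_add, map_add, map_add, add_mul, hφ, hψ, smul_add]
    abel

theorem constDiffOp_monomial_one {α : Fin N →₀ ℕ} (hα : α ≠ 0) :
    constDiffOp (MvPolynomial.monomial α 1) 1 = 0 := by
  obtain ⟨i, hi⟩ := Finsupp.ne_iff.1 hα
  have h : (MvPolynomial.monomial α 1 : MvPolynomial (Fin N) ℂ) =
      MvPolynomial.monomial (α - Finsupp.single i 1) 1 * MvPolynomial.X i := by
    rw [MvPolynomial.X, MvPolynomial.monomial_mul, one_mul, tsub_add_cancel_of_le]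
    rw [Finsupp.single_le_iff]
    exact Nat.one_le_iff_ne_zero.2 hi
  rw [h, map_mul, constDiffOp_X, Module.End.mul_apply, partialOp_apply, Derivation.map_one_eq_zero,
    map_zero]

theorem normalOp_apply_one (φ : MvPolynomial (Fin N) (RatFun N)) :
    normalOp φ 1 = MvPolynomial.coeff 0 φ := by
  induction φ using normalOp_induction with
  | hm α c =>
    rw [normalOp_monomial, MvPolynomial.coeff_monomial]
    split_ifs with h
    · rw [h, MvPolynomial.monomial_zero', RingHom.map_one, map_one constDiffOp]
      exact mul_one c
    · change c * (constDiffOp _ 1) = 0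
      rw [constDiffOp_monomial_one h, mul_zero]
  | ha φ ψ hφ hψ => rw [map_add, LinearMap.add_apply, hφ, hψ, MvPolynomial.coeff_add]

/-- Applying the operator to `1` reads off the constant coefficient. The other coefficients reach
that place by repeated commutators with coordinates, up to nonzero integer factors. -/
theorem normalOp_injective : Function.Injective (normalOp (N := N)) := by
  have key : ∀ (d : ℕ) (α : Fin N →₀ ℕ) (φ : MvPolynomial (Fin N) (RatFun N)), α.degree = d →
      normalOp φ = 0 → MvPolynomial.coeff α φ = 0 := by
    intro d
    induction d with
    | zero =>
      intro α φ hα hφ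
      rw [(Finsupp.degree_eq_zero_iff α).1 hα, ← normalOp_apply_one, hφ, LinearMap.zero_apply]
    | succ d ih =>
      intro α φ hα hφ
      obtain ⟨i, hi⟩ : ∃ i, α i ≠ 0 := by
        by_contra! h
        rw [show α = 0 from Finsupp.ext h, map_zero] at hα
        exact absurd hα (Nat.succ_ne_zero d).symm
      have hle : Finsupp.single i 1 ≤ α := by
        rw [Finsupp.single_le_iff]
        exact Nat.one_le_iff_ne_zero.2 hi
      have h1 : normalOp (MvPolynomial.pderiv i φ) = 0 := by
        have := normalOp_mul_coordX φ i
        rwa [hφ, zero_mul, smul_zero, zero_add, eq_comm] at this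
      have h2 := ih (α - Finsupp.single i 1) _ (by
        have := congrArg Finsupp.degree (tsub_add_cancel_of_le hle)
        rw [map_add, Finsupp.degree_single, hα] at this
        exact Nat.succ_injective this) h1
      rw [MvPolynomial.coeff_pderiv, tsub_add_cancel_of_le hle] at h2
      exact (mul_eq_zero.1 h2).resolve_right (Nat.cast_add_one_ne_zero _)
  rw [injective_iff_map_eq_zero]
  intro φ h
  ext α
  exact key _ α φ rfl h

/-- Multiplication on the right by a function, as a linear map over the rational functions. -/
noncomputable def rightMulOp (f : RatFun N) : Module.End (RatFun N) (Module.End ℂ (RatFun N)) where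
  toFun T := T * mulOp f
  map_add' _ _ := add_mul _ _ _
  map_smul' _ _ := rfl

theorem rightMulOp_apply (f : RatFun N) (T : Module.End ℂ (RatFun N)) :
    rightMulOp f T = T * mulOp f := rfl

/-- For `A = rightMulOp f - μ` one has `A (∂_i T) = ∂_i (A T) + (∂_i μ) T`. The error is a scalar
multiple of `T`, so one more power of `A` suffices. -/
theorem partialOp_mul_mem_maxGenEigenspace {f μ : RatFun N} {T : Module.End ℂ (RatFun N)}
    (hT : T ∈ (rightMulOp f).maxGenEigenspace μ) (i : Fin N) :
    partialOp i * T ∈ (rightMulOp f).maxGenEigenspace μ := by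
  rw [Module.End.mem_maxGenEigenspace] at hT ⊢
  obtain ⟨k, hk⟩ := hT
  set A := rightMulOp f - μ • (1 : Module.End (RatFun N) (Module.End ℂ (RatFun N))) with hA
  have hstep : ∀ T, A (partialOp i * T) = partialOp i * A T + partialD i μ • T := by
    intro T
    have e : ∀ T, A T = T * mulOp f - μ • T := fun T => rfl
    rw [e, e, mul_sub, partialOp_mul_smul, mul_assoc]
    abel
  refine ⟨k + 1, ?_⟩
  induction k generalizing T with
  | zero =>
    rw [pow_zero, Module.End.one_apply] at hk
    rw [hk, mul_zero, map_zero]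
  | succ k ih =>
    rw [pow_succ, Module.End.mul_apply, hstep, map_add, map_smul, hk, smul_zero, add_zero]
    exact ih (by rwa [pow_succ, Module.End.mul_apply] at hk)

/-- The permutation `σ` itself is an eigenvector, as `σ f = σ(f) σ`; partial derivatives on the left
preserve the generalized eigenspace. -/
theorem constDiffOp_mul_permOp_mem (f : RatFun N) (p : MvPolynomial (Fin N) ℂ)
    (σ : Equiv.Perm (Fin N)) :
    constDiffOp p * permOp σ ∈ (rightMulOp f).maxGenEigenspace (permFun σ f) := by
  induction p using MvPolynomial.induction_on with
  | C a =>
    rw [Module.End.mem_maxGenEigenspace]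
    refine ⟨1, ?_⟩
    rw [pow_one, LinearMap.sub_apply, rightMulOp_apply, mul_assoc, permOp_mul_mulOp,
      ← MvPolynomial.algebraMap_eq, AlgHom.commutes, ← mul_assoc, Algebra.commutes, mul_assoc]
    exact sub_self _
  | add p q hp hq => rw [map_add, add_mul]; exact Submodule.add_mem _ hp hq
  | mul_X p i hp =>
    rw [mul_comm, map_mul, constDiffOp_X, mul_assoc]
    exact partialOp_mul_mem_maxGenEigenspace hp i

theorem normalOp_mul_permOp_mem (f : RatFun N) (φ : MvPolynomial (Fin N) (RatFun N))
    (σ : Equiv.Perm (Fin N)) :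
    normalOp φ * permOp σ ∈ (rightMulOp f).maxGenEigenspace (permFun σ f) := by
  induction φ using normalOp_induction with
  | hm α c =>
    rw [normalOp_monomial, ratFun_smul_mul]
    exact Submodule.smul_mem _ _ (constDiffOp_mul_permOp_mem f _ σ)
  | ha φ ψ hφ hψ => rw [map_add, add_mul]; exact Submodule.add_mem _ hφ hψ

theorem exists_permFun_injective :
    ∃ f : RatFun N, Function.Injective fun σ : Equiv.Perm (Fin N) => permFun σ f := by
  -- A linear form with pairwise distinct coefficients: the derivative of its image along `x_k` is
  -- the label of `σ⁻¹ k`.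
  refine ⟨∑ i : Fin N, algebraMap ℂ (RatFun N) ((i : ℕ) : ℂ) * coordX i, fun σ τ h => ?_⟩
  have key : ∀ (σ : Equiv.Perm (Fin N)) (k : Fin N),
      partialD k (permFun σ (∑ i : Fin N, algebraMap ℂ (RatFun N) ((i : ℕ) : ℂ) * coordX i)) =
        algebraMap ℂ (RatFun N) (((σ⁻¹ k : Fin N) : ℕ) : ℂ) := by
    intro σ k
    rw [map_sum, map_sum, Finset.sum_eq_single (σ⁻¹ k)]
    · rw [map_mul, AlgEquiv.commutes, Derivation.leibniz, Derivation.map_algebraMap, smul_zero,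
        add_zero, permFun_coordX, partialD_coordX, if_pos (by simp), smul_eq_mul, mul_one]
    · intro i _ hi
      rw [map_mul, AlgEquiv.commutes, Derivation.leibniz, Derivation.map_algebraMap, smul_zero,
        add_zero, permFun_coordX, partialD_coordX, if_neg, smul_zero]
      rintro rfl
      simp at hi
    · simp
  have h' : ∀ k, σ⁻¹ k = τ⁻¹ k := by
    intro k
    have h1 := congrArg (partialD k) h
    simp only [key] at h1
    have h2 := (algebraMap ℂ (RatFun N)).injective h1
    exact Fin.ext (by exact_mod_cast h2)
  exact inv_injective (Equiv.ext h')

/-- The operators `∂^α σ` are linearly independent over the rational functions. -/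
theorem eq_zero_of_sum_normalOp_eq_zero
    {φ : Equiv.Perm (Fin N) → MvPolynomial (Fin N) (RatFun N)}
    (h : ∑ σ, normalOp (φ σ) * permOp σ = 0) : φ = 0 := by
  obtain ⟨f, hf⟩ := exists_permFun_injective (N := N)
  -- The `σ`-summand lies in the generalized eigenspace for `σ(f)`. These eigenvalues are distinct,
  -- so the summands vanish separately; then the invertible `σ` can be cancelled.
  have hind := ((rightMulOp f).independent_maxGenEigenspace).comp hf
  rw [iSupIndep_iff_finsetSum_eq_zero_imp_eq_zero] at hind
  funext σ
  have h1 : normalOp (φ σ) * permOp σ = 0 :=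
    hind Finset.univ (fun σ => normalOp (φ σ) * permOp σ)
      (fun σ _ => normalOp_mul_permOp_mem f (φ σ) σ) h σ (Finset.mem_univ σ)
  have h2 : normalOp (φ σ) = 0 := by
    rw [← mul_one (normalOp (φ σ)), ← permOp_one, ← mul_inv_cancel σ, permOp_mul, ← mul_assoc, h1,
      zero_mul]
  exact normalOp_injective (h2.trans (map_zero _).symm)

end Symbols

/-! ### Leading symbols and independence of the non-crossing operators. -/

section LinearIndependence

variable {N : ℕ}

/-- Combinations of the operators `∂^α σ` with `|α| < n`. -/
noncomputable def orderLT (N n : ℕ) : Submodule (RatFun N) (Module.End ℂ (RatFun N)) :=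
  Submodule.span (RatFun N) {T | ∃ (p : MvPolynomial (Fin N) ℂ) (σ : Equiv.Perm (Fin N)),
    p.totalDegree < n ∧ T = constDiffOp p * permOp σ}

theorem orderLT_mono {m n : ℕ} (h : m ≤ n) : orderLT N m ≤ orderLT N n :=
  Submodule.span_mono fun _ ⟨p, σ, hp, hT⟩ => ⟨p, σ, hp.trans_le h, hT⟩

theorem complex_smul_eq (c : ℂ) (T : Module.End ℂ (RatFun N)) :
    c • T = algebraMap ℂ (RatFun N) c • T := by
  ext f
  exact Algebra.smul_def c (T f)

theorem complex_smul_mem_orderLT {n : ℕ} {T : Module.End ℂ (RatFun N)} (h : T ∈ orderLT N n)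
    (c : ℂ) : c • T ∈ orderLT N n := by
  rw [complex_smul_eq]
  exact Submodule.smul_mem _ _ h

theorem permOp_mul_mem_orderLT {n : ℕ} {T : Module.End ℂ (RatFun N)} (h : T ∈ orderLT N n)
    (τ : Equiv.Perm (Fin N)) : permOp τ * T ∈ orderLT N n := by
  induction h using Submodule.span_induction with
  | mem T hT =>
    obtain ⟨p, σ, hp, rfl⟩ := hT
    rw [← mul_assoc, permOp_mul_constDiffOp, mul_assoc, ← permOp_mul]
    exact Submodule.subset_span ⟨_, _, (MvPolynomial.totalDegree_rename_le _ _).trans_lt hp, rfl⟩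
  | zero => rw [mul_zero]; exact Submodule.zero_mem _
  | add S T _ _ hS hT => rw [mul_add]; exact Submodule.add_mem _ hS hT
  | smul f T _ hT => rw [permOp_mul_smul]; exact Submodule.smul_mem _ _ hT

theorem partialOp_mul_mem_orderLT {n : ℕ} {T : Module.End ℂ (RatFun N)} (h : T ∈ orderLT N n)
    (i : Fin N) : partialOp i * T ∈ orderLT N (n + 1) := by
  induction h using Submodule.span_induction with
  | mem T hT =>
    obtain ⟨p, σ, hp, rfl⟩ := hT
    rw [← mul_assoc, ← constDiffOp_X, ← map_mul]
    refine Submodule.subset_span ⟨_, σ, (MvPolynomial.totalDegree_mul _ _).trans_lt ?_, rfl⟩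
    rw [MvPolynomial.totalDegree_X]
    omega
  | zero => rw [mul_zero]; exact Submodule.zero_mem _
  | add S T _ _ hS hT => rw [mul_add]; exact Submodule.add_mem _ hS hT
  | smul f T h hT =>
    rw [partialOp_mul_smul]
    exact Submodule.add_mem _ (Submodule.smul_mem _ _ hT)
      (Submodule.smul_mem _ _ (orderLT_mono n.le_succ h))

theorem normalOp_eq_sum (φ : MvPolynomial (Fin N) (RatFun N)) :
    normalOp φ = ∑ α ∈ φ.support,
      MvPolynomial.coeff α φ • constDiffOp (MvPolynomial.monomial α 1) := by
  conv_lhs => rw [MvPolynomial.as_sum φ, map_sum]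
  exact Finset.sum_congr rfl fun α _ => normalOp_monomial α _

theorem degree_eq_of_mem_support {R : Type*} [CommSemiring R] {φ : MvPolynomial (Fin N) R}
    {n : ℕ} (hφ : φ.IsHomogeneous n) {α : Fin N →₀ ℕ} (hα : α ∈ φ.support) : α.degree = n := by
  rw [Finsupp.degree_eq_weight_one]
  exact hφ (MvPolynomial.mem_support_iff.1 hα)

theorem constDiffOp_monomial_mul_mem_orderLT (α : Fin N →₀ ℕ) (σ : Equiv.Perm (Fin N)) :
    constDiffOp (MvPolynomial.monomial α 1) * permOp σ ∈ orderLT N (α.degree + 1) :=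
  Submodule.subset_span ⟨_, σ, Nat.lt_succ_of_le (MvPolynomial.totalDegree_monomial_le _ _), rfl⟩

theorem normalOp_mul_permOp_mem_orderLT {φ : MvPolynomial (Fin N) (RatFun N)} {n : ℕ}
    (hφ : φ.IsHomogeneous n) (σ : Equiv.Perm (Fin N)) :
    normalOp φ * permOp σ ∈ orderLT N (n + 1) := by
  rw [normalOp_eq_sum, Finset.sum_mul]
  refine Submodule.sum_mem _ fun α hα => ?_
  rw [ratFun_smul_mul, ← degree_eq_of_mem_support hφ hα]
  exact Submodule.smul_mem _ _ (constDiffOp_monomial_mul_mem_orderLT α σ)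

/-- The error comes from differentiating the coefficients of `φ`, which does not raise the order in
`∂`. -/
theorem partialOp_mul_normalOp_sub_mem {φ : MvPolynomial (Fin N) (RatFun N)} {n : ℕ}
    (hφ : φ.IsHomogeneous n) (i : Fin N) (σ : Equiv.Perm (Fin N)) :
    partialOp i * (normalOp φ * permOp σ) - normalOp (MvPolynomial.X i * φ) * permOp σ ∈
      orderLT N (n + 1) := by
  have h : partialOp i * (normalOp φ * permOp σ) - normalOp (MvPolynomial.X i * φ) * permOp σ =
      ∑ α ∈ φ.support, partialD i (MvPolynomial.coeff α φ) •
        (constDiffOp (MvPolynomial.monomial α 1) * permOp σ) := by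
    have h1 : normalOp (MvPolynomial.X i * φ) = ∑ α ∈ φ.support, MvPolynomial.coeff α φ •
        (partialOp i * constDiffOp (MvPolynomial.monomial α 1)) := by
      conv_lhs => rw [MvPolynomial.as_sum φ, Finset.mul_sum, map_sum]
      refine Finset.sum_congr rfl fun α _ => ?_
      rw [MvPolynomial.X, MvPolynomial.monomial_mul, normalOp_monomial, one_mul, ← constDiffOp_X,
        ← map_mul, MvPolynomial.X, MvPolynomial.monomial_mul, one_mul]
    rw [h1, normalOp_eq_sum, Finset.sum_mul, Finset.mul_sum, Finset.sum_mul,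
      ← Finset.sum_sub_distrib]
    refine Finset.sum_congr rfl fun α _ => ?_
    rw [ratFun_smul_mul, partialOp_mul_smul, ratFun_smul_mul, mul_assoc, add_sub_cancel_left]
  rw [h]
  refine Submodule.sum_mem _ fun α hα => ?_
  rw [← degree_eq_of_mem_support hφ hα]
  exact Submodule.smul_mem _ _ (constDiffOp_monomial_mul_mem_orderLT α σ)

/-- The reflection terms of `∇_i` do not raise the order, so `∇_i` acts on leading symbols as
multiplication by `p_i` and leaves `σ` unchanged. -/
theorem nablaOp_symbol (g : ℂ) {φ : MvPolynomial (Fin N) (RatFun N)} {n : ℕ}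
    (hφ : φ.IsHomogeneous n) {σ : Equiv.Perm (Fin N)} {T : Module.End ℂ (RatFun N)}
    (hT : T - normalOp φ * permOp σ ∈ orderLT N n) (i : Fin N) :
    nablaOp g i * T - normalOp (MvPolynomial.X i * φ) * permOp σ ∈ orderLT N (n + 1) := by
  have hT' : T ∈ orderLT N (n + 1) := by
    rw [← sub_add_cancel T (normalOp φ * permOp σ)]
    exact Submodule.add_mem _ (orderLT_mono n.le_succ hT) (normalOp_mul_permOp_mem_orderLT hφ σ)
  have h1 := partialOp_mul_mem_orderLT hT i
  have h2 := partialOp_mul_normalOp_sub_mem hφ i σ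
  have h3 : (∑ j ∈ Finset.univ.erase i,
      g • (mulOp (coordX i - coordX j)⁻¹ * permOp (Equiv.swap i j))) * T ∈ orderLT N (n + 1) := by
    rw [Finset.sum_mul]
    refine Submodule.sum_mem _ fun j _ => ?_
    rw [smul_mul_assoc, mul_assoc, ← ratFun_smul_eq]
    exact complex_smul_mem_orderLT (Submodule.smul_mem _ _ (permOp_mul_mem_orderLT hT' _)) g
  have e : nablaOp g i * T - normalOp (MvPolynomial.X i * φ) * permOp σ =
      partialOp i * (T - normalOp φ * permOp σ) + (partialOp i * (normalOp φ * permOp σ) -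
        normalOp (MvPolynomial.X i * φ) * permOp σ) - (∑ j ∈ Finset.univ.erase i,
      g • (mulOp (coordX i - coordX j)⁻¹ * permOp (Equiv.swap i j))) * T := by
    rw [nablaOp_eq, sub_mul, mul_sub]
    abel
  rw [e]
  exact Submodule.sub_mem _ (Submodule.add_mem _ h1 h2) h3

/-- The symbol `x_i p_j - x_j p_i` of the Dunkl angular momentum. -/
noncomputable def angularSymbol (i j : Fin N) : MvPolynomial (Fin N) (RatFun N) :=
  MvPolynomial.C (coordX i) * MvPolynomial.X j - MvPolynomial.C (coordX j) * MvPolynomial.X i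

theorem angularSymbol_isHomogeneous (i j : Fin N) :
    (angularSymbol i j : MvPolynomial (Fin N) (RatFun N)).IsHomogeneous 1 :=
  ((MvPolynomial.isHomogeneous_X _ j).C_mul _).sub ((MvPolynomial.isHomogeneous_X _ i).C_mul _)

theorem angularOp_symbol (g : ℂ) {φ : MvPolynomial (Fin N) (RatFun N)} {n : ℕ}
    (hφ : φ.IsHomogeneous n) {σ : Equiv.Perm (Fin N)} {T : Module.End ℂ (RatFun N)}
    (hT : T - normalOp φ * permOp σ ∈ orderLT N n) (i j : Fin N) :
    angularOp g i j * T - normalOp (angularSymbol i j * φ) * permOp σ ∈ orderLT N (n + 1) := by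
  have e : angularOp g i j * T - normalOp (angularSymbol i j * φ) * permOp σ =
      coordX i • (nablaOp g j * T - normalOp (MvPolynomial.X j * φ) * permOp σ) -
        coordX j • (nablaOp g i * T - normalOp (MvPolynomial.X i * φ) * permOp σ) := by
    rw [angularSymbol, sub_mul, mul_assoc, mul_assoc, ← MvPolynomial.smul_eq_C_mul,
      ← MvPolynomial.smul_eq_C_mul, map_sub, map_smul, map_smul, sub_mul, ratFun_smul_mul,
      ratFun_smul_mul, angularOp, ← ratFun_smul_eq, ← ratFun_smul_eq, sub_mul, ratFun_smul_mul,
      ratFun_smul_mul, smul_sub, smul_sub]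
    abel
  rw [e]
  exact Submodule.sub_mem _ (Submodule.smul_mem _ _ (nablaOp_symbol g hφ hT j))
    (Submodule.smul_mem _ _ (nablaOp_symbol g hφ hT i))

theorem angularWord_symbol (g : ℂ) (L : List (Fin N × Fin N)) (σ : Equiv.Perm (Fin N)) :
    (L.map fun p => (angularSymbol p.1 p.2 : MvPolynomial (Fin N) (RatFun N))).prod.IsHomogeneous
      L.length ∧
    (L.map fun p => angularOp g p.1 p.2).prod * permOp σ -
      normalOp (L.map fun p => angularSymbol p.1 p.2).prod * permOp σ ∈ orderLT N L.length := by
  induction L with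
  | nil =>
    refine ⟨MvPolynomial.isHomogeneous_one _ _, ?_⟩
    have : normalOp (1 : MvPolynomial (Fin N) (RatFun N)) = 1 := by
      rw [← MvPolynomial.C_1, ← MvPolynomial.monomial_zero', normalOp_monomial, one_smul,
        MvPolynomial.monomial_zero', MvPolynomial.C_1, map_one constDiffOp]
    rw [List.map_nil, List.map_nil, List.prod_nil, List.prod_nil, this, sub_self]
    exact Submodule.zero_mem _
  | cons p L ih =>
    simp only [List.map_cons, List.prod_cons, List.length_cons]
    refine ⟨?_, ?_⟩
    · rw [add_comm]
      exact (angularSymbol_isHomogeneous _ _).mul ih.1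
    · rw [mul_assoc]
      exact angularOp_symbol g ih.1 ih.2 _ _

theorem nonCrossingMonomial_symbol (g : ℂ)
    (a : {n : Fin N → Fin N → ℕ // IsNonCrossing n} × Equiv.Perm (Fin N)) :
    (orderedMonomial angularSymbol a.1.1 : MvPolynomial (Fin N) (RatFun N)).IsHomogeneous
      (monomialDegree a.1.1) ∧
    nonCrossingMonomial g a - normalOp (orderedMonomial angularSymbol a.1.1) * permOp a.2 ∈
      orderLT N (monomialDegree a.1.1) := by
  have h := angularWord_symbol g (sortedPairs a.1.1) a.2
  rw [length_sortedPairs, prod_map_sortedPairs (angularSymbol (N := N)),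
    prod_map_sortedPairs (angularOp g)] at h
  exact h

/-- Independence is over `ℂ` only; over the rational functions it fails, for instance through `x_1
M_{23} + x_2 M_{31} + x_3 M_{12} = 0`. It is carried over from the polynomials in `p` and `x` by the
injection `F`, which regards the `x` as coefficients. -/
theorem linearIndependent_angularSymbolMonomial :
    LinearIndependent ℂ fun n : {n : Fin N → Fin N → ℕ // IsNonCrossing n} =>
      (orderedMonomial angularSymbol n.1 : MvPolynomial (Fin N) (RatFun N)) := by
  let F : MvPolynomial (Fin N ⊕ₗ Fin N) ℂ →ₐ[ℂ] MvPolynomial (Fin N) (RatFun N) :=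
    ((MvPolynomial.mapAlgHom (IsScalarTower.toAlgHom ℂ (MvPolynomial (Fin N) ℂ) (RatFun N))).comp
      (MvPolynomial.sumAlgEquiv ℂ (Fin N) (Fin N)).toAlgHom).comp
        (MvPolynomial.rename (ofLex : Fin N ⊕ₗ Fin N → Fin N ⊕ Fin N))
  have hF : Function.Injective F :=
    ((MvPolynomial.map_injective _ (IsFractionRing.injective (MvPolynomial (Fin N) ℂ)
      (RatFun N))).comp (MvPolynomial.sumAlgEquiv ℂ (Fin N) (Fin N)).injective).comp
        (MvPolynomial.rename_injective _ ofLex.injective)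
  have hl : ∀ i : Fin N, F (MvPolynomial.X (toLex (Sum.inl i))) = MvPolynomial.X i := by
    intro i
    simp [F]
  have hr : ∀ i : Fin N, F (MvPolynomial.X (toLex (Sum.inr i))) = MvPolynomial.C (coordX i) := by
    intro i
    simp [F, coordX]
  have hp : ∀ i j : Fin N, F (pluckerPoly i j) = angularSymbol i j := by
    intro i j
    rw [pluckerPoly, angularSymbol, map_sub, map_mul, map_mul, hl, hl, hr, hr]
  have h := linearIndependent_pluckerMonomial (N := N).map' F.toLinearMap
    (LinearMap.ker_eq_bot.2 hF)
  have e : (fun n : {n : Fin N → Fin N → ℕ // IsNonCrossing n} =>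
      (orderedMonomial angularSymbol n.1 : MvPolynomial (Fin N) (RatFun N))) =
      F.toLinearMap ∘ fun n => orderedMonomial pluckerPoly n.1 := by
    funext n
    simp only [Function.comp_apply, AlgHom.toLinearMap_apply, orderedMonomial_eq_prod, map_prod,
      map_pow, hp]
  rw [e]
  exact h

theorem exists_sum_of_mem_orderLT {n : ℕ} {T : Module.End ℂ (RatFun N)} (h : T ∈ orderLT N n) :
    ∃ ψ : Equiv.Perm (Fin N) → MvPolynomial (Fin N) (RatFun N),
      (∀ σ, MvPolynomial.homogeneousComponent n (ψ σ) = 0) ∧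
        T = ∑ σ, normalOp (ψ σ) * permOp σ := by
  induction h using Submodule.span_induction with
  | mem T hT =>
    obtain ⟨p, τ, hp, rfl⟩ := hT
    refine ⟨Pi.single τ (MvPolynomial.map (algebraMap ℂ (RatFun N)) p), fun σ => ?_, ?_⟩
    · rcases eq_or_ne σ τ with rfl | h
      · rw [Pi.single_eq_same]
        exact MvPolynomial.homogeneousComponent_eq_zero _ _
          ((Finset.sup_mono (MvPolynomial.support_map_subset _ _)).trans_lt hp)
      · rw [Pi.single_eq_of_ne h, map_zero]
    · rw [Finset.sum_eq_single τ]
      · rw [Pi.single_eq_same]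
        congr 1
        clear hp
        induction p using MvPolynomial.induction_on' with
        | monomial α c =>
          rw [MvPolynomial.map_monomial, normalOp_monomial, ← complex_smul_eq, ← map_smul,
            MvPolynomial.smul_monomial, smul_eq_mul, mul_one]
        | add p q hp hq => rw [map_add, map_add, map_add, ← hp, ← hq]
      · intro σ _ h
        rw [Pi.single_eq_of_ne h, map_zero, zero_mul]
      · simp
  | zero => exact ⟨0, fun σ => by simp, by simp⟩
  | add S T _ _ hS hT =>
    obtain ⟨φ, hφ, rfl⟩ := hS
    obtain ⟨ψ, hψ, rfl⟩ := hT
    refine ⟨φ + ψ, fun σ => ?_, ?_⟩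
    · rw [Pi.add_apply, map_add, hφ, hψ, add_zero]
    · rw [← Finset.sum_add_distrib]
      exact Finset.sum_congr rfl fun σ _ => by rw [Pi.add_apply, map_add, add_mul]
  | smul f T _ hT =>
    obtain ⟨ψ, hψ, rfl⟩ := hT
    refine ⟨f • ψ, fun σ => ?_, ?_⟩
    · rw [Pi.smul_apply, map_smul, hψ, smul_zero]
    · rw [Finset.smul_sum]
      exact Finset.sum_congr rfl fun σ _ => by
        rw [Pi.smul_apply, map_smul, ratFun_smul_mul]

/-- The top degree of a vanishing combination is treated first: its symbols, sorted by `σ`, must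
cancel, and they are independent over `ℂ`. The remaining terms have smaller degree and are handled
by induction. -/
theorem linearIndependent_nonCrossingMonomial (g : ℂ) :
    LinearIndependent ℂ (nonCrossingMonomial (N := N) g) := by
  have key : ∀ (d : ℕ) (s : Finset {n : Fin N → Fin N → ℕ // IsNonCrossing n})
      (c : {n : Fin N → Fin N → ℕ // IsNonCrossing n} → Equiv.Perm (Fin N) → ℂ),
      (∀ n ∈ s, monomialDegree n.1 < d) →
      ∑ n ∈ s, ∑ σ, c n σ • nonCrossingMonomial g (n, σ) = 0 → ∀ n ∈ s, ∀ σ, c n σ = 0 := by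
    intro d
    induction d with
    | zero => exact fun s c hs _ n hn => absurd (hs n hn) (Nat.not_lt_zero _)
    | succ d ih =>
      intro s c hs hsum
      classical
      have htop : ∀ n ∈ s.filter (fun n => monomialDegree n.1 = d), ∀ σ, c n σ = 0 := by
        set φ : Equiv.Perm (Fin N) → MvPolynomial (Fin N) (RatFun N) := fun σ =>
          ∑ n ∈ s.filter (fun n => monomialDegree n.1 = d),
            algebraMap ℂ (RatFun N) (c n σ) • orderedMonomial angularSymbol n.1 with hφ
        have hmem : ∑ σ, normalOp (φ σ) * permOp σ ∈ orderLT N d := by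
          have e : ∑ σ, normalOp (φ σ) * permOp σ =
              -(∑ n ∈ s.filter (fun n => ¬ monomialDegree n.1 = d), ∑ σ,
                c n σ • nonCrossingMonomial g (n, σ) +
              ∑ n ∈ s.filter (fun n => monomialDegree n.1 = d), ∑ σ,
                c n σ • (nonCrossingMonomial g (n, σ) -
                  normalOp (orderedMonomial angularSymbol n.1) * permOp σ)) := by
            have e1 : ∑ σ, normalOp (φ σ) * permOp σ =
                ∑ n ∈ s.filter (fun n => monomialDegree n.1 = d), ∑ σ,
                  c n σ • (normalOp (orderedMonomial angularSymbol n.1) * permOp σ) := by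
              rw [Finset.sum_comm]
              refine Finset.sum_congr rfl fun σ _ => ?_
              rw [hφ, map_sum, Finset.sum_mul]
              refine Finset.sum_congr rfl fun n _ => ?_
              rw [map_smul, ratFun_smul_mul, complex_smul_eq]
            have e2 := Finset.sum_filter_add_sum_filter_not s
              (fun n => monomialDegree n.1 = d)
              (fun n => ∑ σ, c n σ • nonCrossingMonomial g (n, σ))
            rw [hsum] at e2
            simp only [smul_sub, Finset.sum_sub_distrib]
            rw [e1, eq_neg_iff_add_eq_zero, ← e2]
            abel
          rw [e]
          refine Submodule.neg_mem _ (Submodule.add_mem _ ?_ ?_)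
          · refine Submodule.sum_mem _ fun n hn => Submodule.sum_mem _ fun σ _ =>
              complex_smul_mem_orderLT ?_ _
            obtain ⟨h1, h2⟩ := Finset.mem_filter.1 hn
            have hlt : monomialDegree n.1 + 1 ≤ d := by
              have := hs n h1
              omega
            obtain ⟨h3, h4⟩ := nonCrossingMonomial_symbol g (n, σ)
            rw [← sub_add_cancel (nonCrossingMonomial g (n, σ))
              (normalOp (orderedMonomial angularSymbol n.1) * permOp σ)]
            exact Submodule.add_mem _ (orderLT_mono (Nat.le_of_succ_le hlt) h4)
              (orderLT_mono hlt (normalOp_mul_permOp_mem_orderLT h3 σ))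
          · refine Submodule.sum_mem _ fun n hn => Submodule.sum_mem _ fun σ _ =>
              complex_smul_mem_orderLT ?_ _
            rw [← (Finset.mem_filter.1 hn).2]
            exact (nonCrossingMonomial_symbol g (n, σ)).2
        obtain ⟨ψ, hψ, e⟩ := exists_sum_of_mem_orderLT hmem
        -- The same operator is written with symbols homogeneous of degree `d` and with symbols `ψ`
        -- that have no component of degree `d`. Uniqueness of symbols forces both to vanish in that
        -- degree.
        have h0 : φ - ψ = 0 := eq_zero_of_sum_normalOp_eq_zero (by
          simp only [Pi.sub_apply, map_sub, sub_mul, Finset.sum_sub_distrib]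
          rw [e, sub_self])
        intro n hn σ
        have h1 : φ σ = 0 := by
          have hhom : (φ σ).IsHomogeneous d := by
            refine MvPolynomial.IsHomogeneous.sum _ _ _ fun n hn => ?_
            rw [MvPolynomial.smul_eq_C_mul, ← (Finset.mem_filter.1 hn).2]
            exact (nonCrossingMonomial_symbol g (n, σ)).1.C_mul _
          rw [← MvPolynomial.homogeneousComponent_eq_self hhom, sub_eq_zero.1 h0, hψ]
        refine linearIndependent_iff'.1 linearIndependent_angularSymbolMonomial
          (s.filter (fun n => monomialDegree n.1 = d)) (fun n => c n σ) ?_ n hn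
        rw [← h1]
        refine Finset.sum_congr rfl fun n _ => ?_
        rw [algebraMap_smul]
      have hrest := ih (s.filter (fun n => ¬ monomialDegree n.1 = d)) c
        (fun n hn => by
          obtain ⟨h1, h2⟩ := Finset.mem_filter.1 hn
          have := hs n h1
          omega)
        (by
          rw [← hsum, ← Finset.sum_filter_add_sum_filter_not s (fun n => monomialDegree n.1 = d),
            eq_comm, add_eq_right]
          exact Finset.sum_eq_zero fun n hn => Finset.sum_eq_zero fun σ _ => by
            rw [htop n hn σ, zero_smul])
      intro n hn σ
      by_cases h : monomialDegree n.1 = d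
      · exact htop n (Finset.mem_filter.2 ⟨hn, h⟩) σ
      · exact hrest n (Finset.mem_filter.2 ⟨hn, h⟩) σ
  classical
  rw [linearIndependent_iff]
  intro l hl
  ext ⟨n, σ⟩
  by_cases hn : n ∈ l.support.image Prod.fst
  · refine key ((l.support.image Prod.fst).sup (fun n => monomialDegree n.1) + 1) _
      (fun n σ => l (n, σ))
      (fun n hn => Nat.lt_succ_of_le (Finset.le_sup (f := fun n => monomialDegree n.1) hn)) ?_ n hn σ
    rw [← Finset.sum_product', ← hl, Finsupp.linearCombination_apply, Finsupp.sum]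
    symm
    refine Finset.sum_subset (fun a ha => ?_) fun a _ ha => ?_
    · exact Finset.mem_product.2 ⟨Finset.mem_image_of_mem _ ha, Finset.mem_univ _⟩
    · rw [Finsupp.notMem_support_iff.1 ha, zero_smul]
  · by_contra h
    exact hn (Finset.mem_image.2 ⟨(n, σ), Finsupp.mem_support_iff.2 h, rfl⟩)

end LinearIndependence

/-! ### Homomorphisms out of the abstract quotient. -/

section Presentation

variable {N : ℕ} {R : Type*} [CommRing R]

theorem map_orderedMonomial {A B F : Type*} [Monoid A] [Monoid B] [FunLike F A B]
    [MonoidHomClass F A B] (f : F) (M : Fin N → Fin N → A) (n : Fin N → Fin N → ℕ) :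
    f (orderedMonomial M n) = orderedMonomial (fun i j => f (M i j)) n := by
  simp only [orderedMonomial, map_list_prod, List.map_flatMap, List.map_map, Function.comp_def,
    map_pow]

theorem map_smashS {B : Type*} [Ring B] [Algebra R B] (F : Smash N R →ₐ[R] B) (g : R)
    (i j : Fin N) :
    F (smashS g i j) = if i = j then
      1 + g • ∑ k ∈ Finset.univ.erase i, F (smashPerm R (Equiv.swap i k))
      else -(g • F (smashPerm R (Equiv.swap i j))) := by
  rw [smashS]
  split_ifs
  · rw [map_add, map_one, map_smul, map_sum]
  · rw [map_neg, map_smul]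

/-- Stated for an arbitrary base and target, since it yields both the map to operators and the
specialization from `ℂ[t]`. -/
theorem exists_dunklQuot_lift {A : Type*} [Ring A] [Algebra R A] (g : R) (m S : Fin N → Fin N → A)
    (ρ : Equiv.Perm (Fin N) →* A) (hself : ∀ i, m i i = 0) (hanti : ∀ i j, m j i = -m i j)
    (hcomm : ∀ σ i j, ρ σ * m i j = m (σ i) (σ j) * ρ σ)
    (hS : ∀ i j, S i j = if i = j then 1 + g • ∑ k ∈ Finset.univ.erase i, ρ (Equiv.swap i k)
      else -(g • ρ (Equiv.swap i j)))
    (hbracket : ∀ i j k l, m i j * m k l - m k l * m i j =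
      m i l * S j k + m j k * S i l - m i k * S l j - m j l * S i k)
    (hcross : ∀ i j k l, m i j * m k l + m j k * m i l + m k i * m j l =
      m i j * S k l + m j k * S i l + m k i * S j l) :
    ∃ F : DunklQuot N g →ₐ[R] A,
      (∀ i j, F (QuotBy.proj R (dunklRelations N g) (smashM R i j)) = m i j) ∧
      ∀ σ, F (QuotBy.proj R (dunklRelations N g) (smashPerm R σ)) = ρ σ := by
  obtain ⟨F, hm, hρ⟩ := exists_smash_lift (R := R) m ρ hself hanti hcomm
  have hFS : ∀ i j, F (smashS g i j) = S i j := fun i j => by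
    rw [map_smashS, hS]
    simp only [hρ]
  have hF : ∀ ⦃x y : Smash N R⦄, x ∈ dunklRelations N g ∧ y = 0 → F x = F y := by
    rintro _ _ ⟨⟨i, j, k, l, rfl | rfl⟩, rfl⟩
    · simp only [commRel, map_sub, map_add, map_mul, hm, hFS, map_zero]
      rw [hbracket, sub_self]
    · simp only [crossRel, map_sub, map_add, map_mul, hm, hFS, map_zero]
      rw [hcross, sub_self]
  refine ⟨RingQuot.liftAlgHom R ⟨F, hF⟩, fun i j => ?_, fun σ => ?_⟩
  · rw [← hm]
    exact RingQuot.liftAlgHom_mkAlgHom_apply R F hF _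
  · rw [← hρ]
    exact RingQuot.liftAlgHom_mkAlgHom_apply R F hF _

theorem proj_smashM_bracket (g : R) (i j k l : Fin N) :
    letI π := QuotBy.proj R (dunklRelations N g)
    π (smashM R i j) * π (smashM R k l) - π (smashM R k l) * π (smashM R i j) =
      π (smashM R i l) * π (smashS g j k) + π (smashM R j k) * π (smashS g i l) -
        π (smashM R i k) * π (smashS g l j) - π (smashM R j l) * π (smashS g i k) := by
  have h := QuotBy.proj_eq_zero (R := R) (show commRel g i j k l ∈ dunklRelations N g from
    ⟨i, j, k, l, Or.inl rfl⟩)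
  simp only [commRel, map_sub, map_add, map_mul] at h
  exact sub_eq_zero.1 h

theorem proj_smashM_cross (g : R) (i j k l : Fin N) :
    letI π := QuotBy.proj R (dunklRelations N g)
    π (smashM R i j) * π (smashM R k l) + π (smashM R j k) * π (smashM R i l) +
      π (smashM R k i) * π (smashM R j l) =
      π (smashM R i j) * π (smashS g k l) + π (smashM R j k) * π (smashS g i l) +
        π (smashM R k i) * π (smashS g j l) := by
  have h := QuotBy.proj_eq_zero (R := R) (show crossRel g i j k l ∈ dunklRelations N g from
    ⟨i, j, k, l, Or.inr rfl⟩)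
  simp only [crossRel, map_sub, map_add, map_mul] at h
  exact sub_eq_zero.1 h

theorem map_proj_smashMonomial {A : Type*} [Ring A] {g : R} (F : DunklQuot N g →+* A)
    (a : {n : Fin N → Fin N → ℕ // IsNonCrossing n} × Equiv.Perm (Fin N)) :
    F (QuotBy.proj R (dunklRelations N g) (smashMonomial R a)) =
      orderedMonomial (fun i j => F (QuotBy.proj R (dunklRelations N g) (smashM R i j))) a.1.1 *
        F (QuotBy.proj R (dunklRelations N g) (smashPerm R a.2)) := by
  rw [smashMonomial, map_mul, map_mul, map_orderedMonomial, map_orderedMonomial]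

end Presentation

/-! ### Comparison of the abstract quotient with the operator algebra. -/

section Operators

variable {N : ℕ}

theorem exists_dunklQuot_to_operators (g : ℂ) :
    ∃ F : DunklQuot N g →ₐ[ℂ] Module.End ℂ (RatFun N),
      (∀ i j, F (QuotBy.proj ℂ (dunklRelations N g) (smashM ℂ i j)) = angularOp g i j) ∧
      ∀ σ, F (QuotBy.proj ℂ (dunklRelations N g) (smashPerm ℂ σ)) = permOp σ :=
  exists_dunklQuot_lift g (angularOp g) (permSOp g) permOpHom (angularOp_self g) (angularOp_swap g)
    (permOp_mul_angularOp g) (fun _ _ => rfl) (angularOp_commutator g) (angularOp_crossing g)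

theorem nonCrossingMonomial_mem_dunklAlgebra (g : ℂ)
    (a : {n : Fin N → Fin N → ℕ // IsNonCrossing n} × Equiv.Perm (Fin N)) :
    nonCrossingMonomial g a ∈ dunklAlgebra N g := by
  refine (dunklAlgebra N g).mul_mem ((dunklAlgebra N g).list_prod_mem fun x hx => ?_)
    (Algebra.subset_adjoin (Or.inr ⟨_, rfl⟩))
  simp only [List.mem_flatMap, List.mem_map] at hx
  obtain ⟨i, -, j, -, rfl⟩ := hx
  exact (dunklAlgebra N g).pow_mem (Algebra.subset_adjoin (Or.inl ⟨i, j, rfl⟩)) _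

/-- The monomials span the quotient and have independent images, which makes the map to operators
injective. Its image is spanned by those images and contains the generators, so it is the whole
Dunkl algebra. -/
theorem exists_dunklQuot_equiv (g : ℂ) :
    (∃ Φ : DunklQuot N g ≃ₐ[ℂ] dunklAlgebra N g,
      (∀ i j : Fin N, (Φ (QuotBy.proj ℂ (dunklRelations N g) (smashM ℂ i j)) :
        Module.End ℂ (RatFun N)) = angularOp g i j) ∧
      (∀ σ : Equiv.Perm (Fin N), (Φ (QuotBy.proj ℂ (dunklRelations N g) (smashPerm ℂ σ)) :
        Module.End ℂ (RatFun N)) = permOp σ)) ∧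
    Submodule.span ℂ (Set.range (nonCrossingMonomial (N := N) g)) =
      Subalgebra.toSubmodule (dunklAlgebra N g) ∧
    LinearIndependent ℂ (fun a => QuotBy.proj ℂ (dunklRelations N g) (smashMonomial ℂ a)) := by
  obtain ⟨F, hm, hρ⟩ := exists_dunklQuot_to_operators (N := N) g
  have hF : F.toLinearMap ∘ (fun a => QuotBy.proj ℂ (dunklRelations N g) (smashMonomial ℂ a)) =
      nonCrossingMonomial g := by
    funext a
    have h := map_proj_smashMonomial (F : DunklQuot N g →+* Module.End ℂ (RatFun N)) a
    simp only [AlgHom.coe_toRingHom, hm, hρ] at h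
    exact h
  have hrange : LinearMap.range F.toLinearMap =
      Submodule.span ℂ (Set.range (nonCrossingMonomial (N := N) g)) := by
    rw [LinearMap.range_eq_map, ← span_proj_smashMonomial g, Submodule.map_span, ← Set.range_comp,
      hF]
  have hle : dunklAlgebra N g ≤ F.range := by
    refine Algebra.adjoin_le ?_
    rintro _ (⟨k, l, rfl⟩ | ⟨σ, rfl⟩)
    · exact ⟨_, hm k l⟩
    · exact ⟨_, hρ σ⟩
  have hge : Submodule.span ℂ (Set.range (nonCrossingMonomial (N := N) g)) ≤
      Subalgebra.toSubmodule (dunklAlgebra N g) :=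
    Submodule.span_le.2 (by rintro _ ⟨a, rfl⟩; exact nonCrossingMonomial_mem_dunklAlgebra g a)
  have heq : F.range = dunklAlgebra N g :=
    le_antisymm (fun x hx => hge (hrange ▸ hx)) hle
  have hind : LinearIndependent ℂ
      (fun a => QuotBy.proj ℂ (dunklRelations N g) (smashMonomial (N := N) ℂ a)) := by
    refine LinearIndependent.of_comp F.toLinearMap ?_
    rw [hF]
    exact linearIndependent_nonCrossingMonomial g
  have hinj : Function.Injective F := by
    rw [injective_iff_map_eq_zero]
    intro x hx
    obtain ⟨l, rfl⟩ := (Finsupp.mem_span_range_iff_exists_finsupp (R := ℂ)).1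
      ((span_proj_smashMonomial (N := N) g).ge (Submodule.mem_top (x := x)))
    rw [linearIndependent_iff.1 (linearIndependent_nonCrossingMonomial (N := N) g) l,
      Finsupp.sum_zero_index]
    rw [← hF, ← Finsupp.apply_linearCombination]
    exact hx
  exact ⟨⟨(AlgEquiv.ofInjective F hinj).trans (Subalgebra.equivOfEq _ _ heq), hm, hρ⟩,
    le_antisymm hge fun x hx => hrange ▸ hle hx, hind⟩

end Operators

/-! ### The PBW property from independence of the monomials. -/

section PBW

variable {N : ℕ} {R : Type*} [CommRing R]

theorem mem_dunklQuadPart_of_proj_eq_zero {g : R} {n : ℕ} {t : Smash N R}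
    (ht : t ∈ smashGrading N R n)
    (h : QuotBy.proj R (quadraticParts (smashGrading N R) (dunklRelations N g)) t = 0) :
    t ∈ dunklQuadPart g n :=
  mem_quadraticIdealPart_of_proj_eq_zero (R := R) (T := Smash N R) (𝒯 := smashGrading N R)
    (P := dunklRelations N g) (fun ha hb => mul_mem_smashGrading ha hb) one_mem_smashGrading
    mem_iSup_smashGrading (fun n => smashProj n) (fun _ _ hx => smashProj_of_mem hx)
    (fun _ _ hmn _ hx => smashProj_of_mem_ne hmn hx) ht h

theorem QuotBy.proj_eq_zero_of_mem_quadraticIdealPart {T : Type*} [Ring T] [Algebra R T]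
    {𝒯 : ℕ → Submodule R T} {P : Set T} {n : ℕ} {x : T} (hx : x ∈ quadraticIdealPart 𝒯 P n) :
    QuotBy.proj R (quadraticParts 𝒯 P) x = 0 := by
  refine (Submodule.span_le.2 ?_ :
    _ ≤ LinearMap.ker (QuotBy.proj R (quadraticParts 𝒯 P)).toLinearMap) hx
  rintro _ ⟨p, r, -, a, -, q, hq, b, -, rfl⟩
  change QuotBy.proj R (quadraticParts 𝒯 P) (a * q * b) = 0
  rw [map_mul, map_mul, QuotBy.proj_eq_zero hq, mul_zero, zero_mul]

/-- Straightening writes `t` as a combination `u` of monomials of degree `n` plus an element of the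
quadratic ideal. The image of `u` is also spanned by monomials of degree below `n`, so independence
gives `u = 0`. -/
theorem mem_dunklQuadPart_of_proj_mem {g : R}
    (hind : LinearIndependent R
      (fun a => QuotBy.proj R (dunklRelations N g) (smashMonomial R a)))
    {n : ℕ} {t : Smash N R} (ht : t ∈ smashGrading N R n)
    (h : QuotBy.proj R (dunklRelations N g) t ∈
      quotDegreeLT (smashGrading N R) (dunklRelations N g) n) : t ∈ dunklQuadPart g n := by
  obtain ⟨u, hu, w, hw, rfl⟩ := Submodule.mem_sup.1 (smashGrading_le_smashMonomial_sup g n ht)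
  set π := QuotBy.proj R (dunklRelations N g) with hπ
  have h1 : π u ∈ quotDegreeLT (smashGrading N R) (dunklRelations N g) n := by
    have := Submodule.sub_mem _ h
      (proj_mem_of_mem_quadraticIdealPart (R := R) mul_mem_smashGrading hw)
    rwa [map_add, add_sub_cancel_right] at this
  have h2 : π u ∈ Submodule.span R ((fun a => π (smashMonomial R a)) ''
      {a | monomialDegree a.1.1 = n}) := by
    have := Submodule.mem_map_of_mem (f := π.toLinearMap) hu
    rw [Submodule.map_span, ← Set.image_comp] at this
    exact this
  have hdisj : Disjoint
      {a : {n : Fin N → Fin N → ℕ // IsNonCrossing n} × Equiv.Perm (Fin N) |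
        monomialDegree a.1.1 = n} {a | monomialDegree a.1.1 < n} :=
    Set.disjoint_left.2 fun a (h : _ = n) (h' : _ < n) => h'.ne h
  have h3 : π u = 0 := Submodule.disjoint_def.1 (hind.disjoint_span_image hdisj) _ h2
    (quotDegreeLT_le_span g n h1)
  obtain ⟨c, hc, rfl⟩ := (Finsupp.mem_span_image_iff_linearCombination R).1 hu
  have h4 : c = 0 := by
    refine linearIndependent_iff.1 hind c ?_
    rw [← h3]
    exact (Finsupp.apply_linearCombination R π.toLinearMap (smashMonomial R) c).symm
  rw [h4, map_zero, zero_add]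
  exact hw

/-- Both graded components are quotients of `𝒯 n`, so the natural map between them is bijective as
soon as the two kernels agree. -/
theorem isPBWQuadratic_of_proj_eq_zero_iff {T : Type*} [Ring T] [Algebra R T]
    {𝒯 : ℕ → Submodule R T} {P : Set T} (hdeg : ∀ r ∈ P, r ∈ degreeLT 𝒯 3)
    (h : ∀ n, ∀ t ∈ 𝒯 n, QuotBy.proj R (quadraticParts 𝒯 P) t = 0 ↔
      QuotBy.proj R P t ∈ quotDegreeLT 𝒯 P n) : IsPBWQuadratic 𝒯 P := by
  refine ⟨hdeg, fun n => ?_⟩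
  let α : 𝒯 n →ₗ[R] quadComponent 𝒯 P n :=
    ((QuotBy.proj R (quadraticParts 𝒯 P)).toLinearMap ∘ₗ (𝒯 n).subtype).codRestrict _
      fun t => proj_mem_quadComponent 𝒯 P n t.2
  let β : 𝒯 n →ₗ[R] grComponent 𝒯 P n := Submodule.mkQ _ ∘ₗ
    ((QuotBy.proj R P).toLinearMap ∘ₗ (𝒯 n).subtype).codRestrict (quotDegreeLT 𝒯 P (n + 1))
      fun t => proj_mem_quotDegreeLT 𝒯 P n t.2
  have hα : Function.Surjective α := by
    rintro ⟨_, t, ht, rfl⟩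
    exact ⟨⟨t, ht⟩, rfl⟩
  have hβ : Function.Surjective β := by
    intro y
    obtain ⟨⟨x, hx⟩, rfl⟩ := Submodule.mkQ_surjective _ y
    have hx' := hx
    rw [quotDegreeLT_succ] at hx'
    obtain ⟨u, hu, _, ⟨t, ht, rfl⟩, rfl⟩ := Submodule.mem_sup.1 hx'
    refine ⟨⟨t, ht⟩, ?_⟩
    refine (Submodule.Quotient.eq _).2 ?_
    change QuotBy.proj R P t - (u + QuotBy.proj R P t) ∈ quotDegreeLT 𝒯 P n
    rw [sub_add_cancel_right]
    exact Submodule.neg_mem _ hu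
  have hker : LinearMap.ker α = LinearMap.ker β := by
    ext ⟨t, ht⟩
    have e1 : α ⟨t, ht⟩ = 0 ↔ QuotBy.proj R (quadraticParts 𝒯 P) t = 0 := Subtype.ext_iff
    have e2 : β ⟨t, ht⟩ = 0 ↔ QuotBy.proj R P t ∈ quotDegreeLT 𝒯 P n :=
      Submodule.Quotient.mk_eq_zero _
    rw [LinearMap.mem_ker, LinearMap.mem_ker, e1, e2]
    exact h n t ht
  let e := (α.quotKerEquivOfSurjective hα).symm.trans
    ((Submodule.quotEquivOfEq _ _ hker).trans (β.quotKerEquivOfSurjective hβ))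
  refine ⟨e, fun t ht => ?_⟩
  change e (α ⟨t, ht⟩) = β ⟨t, ht⟩
  have : (α.quotKerEquivOfSurjective hα).symm (α ⟨t, ht⟩) = Submodule.Quotient.mk ⟨t, ht⟩ := by
    rw [LinearEquiv.symm_apply_eq]
    rfl
  simp only [e, LinearEquiv.trans_apply, this]
  rfl

theorem isPBWQuadratic_dunkl {g : R} (hind : LinearIndependent R
    (fun a => QuotBy.proj R (dunklRelations N g) (smashMonomial R a))) :
    IsPBWQuadratic (smashGrading N R) (dunklRelations N g) :=
  isPBWQuadratic_of_proj_eq_zero_iff (dunklRelations_le_degree_two g) fun _ _ ht =>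
    ⟨fun h => proj_mem_of_mem_quadraticIdealPart (R := R) mul_mem_smashGrading
        (mem_dunklQuadPart_of_proj_eq_zero ht h),
      fun h => QuotBy.proj_eq_zero_of_mem_quadraticIdealPart
        (mem_dunklQuadPart_of_proj_mem hind ht h)⟩

end PBW

/-! ### The family over `ℂ[t]` and its fibres. -/

section Family

variable {N : ℕ}

theorem exists_specialization (g : ℂ) :
    ∃ f : DunklQuot N (Polynomial.X : Polynomial ℂ) →+* DunklQuot N g,
      (∀ c a, f (c • a) = Polynomial.eval g c • f a) ∧
      (∀ i j : Fin N,
        f (QuotBy.proj (Polynomial ℂ) (dunklRelations N Polynomial.X)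
            (smashM (Polynomial ℂ) i j)) =
          QuotBy.proj ℂ (dunklRelations N g) (smashM ℂ i j)) ∧
      (∀ σ : Equiv.Perm (Fin N),
        f (QuotBy.proj (Polynomial ℂ) (dunklRelations N Polynomial.X)
            (smashPerm (Polynomial ℂ) σ)) =
          QuotBy.proj ℂ (dunklRelations N g) (smashPerm ℂ σ)) := by
  -- Through evaluation at `g` the fibre becomes a `ℂ[t]`-algebra in which the parameter `t` acts as
  -- `g`, so the universal property over `ℂ[t]` applies.
  let _ : Algebra (Polynomial ℂ) (DunklQuot N g) :=
    Algebra.compHom _ (Polynomial.evalRingHom g)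
  have hsmul : ∀ (c : Polynomial ℂ) (a : DunklQuot N g), c • a = Polynomial.eval g c • a :=
    fun _ _ => rfl
  set π := QuotBy.proj ℂ (dunklRelations N g) with hπ
  let ρ : Equiv.Perm (Fin N) →* DunklQuot N g :=
    { toFun := fun σ => π (smashPerm ℂ σ)
      map_one' := by rw [smashPerm_one, map_one]
      map_mul' := fun σ τ => by rw [smashPerm_mul, map_mul] }
  obtain ⟨F, hm, hρ⟩ := exists_dunklQuot_lift (R := Polynomial ℂ) (Polynomial.X : Polynomial ℂ)
    (fun i j : Fin N => π (smashM ℂ i j)) (fun i j => π (smashS g i j)) ρ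
    (fun i => by rw [smashM_self, map_zero])
    (fun i j => by rw [smashM_swap, map_neg])
    (fun σ i j => by
      change π (smashPerm ℂ σ) * π (smashM ℂ i j) = _ * π (smashPerm ℂ σ)
      rw [← map_mul, smashPerm_mul_smashM, map_mul])
    (fun i j => by
      rw [map_smashS, hsmul, hsmul, Polynomial.eval_X]
      rfl)
    (proj_smashM_bracket g) (proj_smashM_cross g)
  exact ⟨F, fun c a => map_smul F c a, hm, hρ⟩

theorem map_proj_smashMonomial_specialization {g : ℂ}
    {f : DunklQuot N (Polynomial.X : Polynomial ℂ) →+* DunklQuot N g}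
    (hm : ∀ i j : Fin N,
        f (QuotBy.proj (Polynomial ℂ) (dunklRelations N Polynomial.X)
            (smashM (Polynomial ℂ) i j)) =
          QuotBy.proj ℂ (dunklRelations N g) (smashM ℂ i j))
    (hρ : ∀ σ : Equiv.Perm (Fin N),
        f (QuotBy.proj (Polynomial ℂ) (dunklRelations N Polynomial.X)
            (smashPerm (Polynomial ℂ) σ)) =
          QuotBy.proj ℂ (dunklRelations N g) (smashPerm ℂ σ))
    (a : {n : Fin N → Fin N → ℕ // IsNonCrossing n} × Equiv.Perm (Fin N)) :
    f (QuotBy.proj (Polynomial ℂ) (dunklRelations N Polynomial.X)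
      (smashMonomial (Polynomial ℂ) a)) =
      QuotBy.proj ℂ (dunklRelations N g) (smashMonomial ℂ a) := by
  rw [map_proj_smashMonomial]
  simp only [hm, hρ]
  exact (map_proj_smashMonomial (RingHom.id (DunklQuot N g)) a).symm

theorem map_linearCombination_eval {ι A B : Type*} [Ring A] [Algebra (Polynomial ℂ) A] [Ring B]
    [Algebra ℂ B] {g : ℂ} {f : A →+* B} (hf : ∀ c a, f (c • a) = Polynomial.eval g c • f a)
    {v : ι → A} {w : ι → B} (hv : ∀ i, f (v i) = w i) (l : ι →₀ Polynomial ℂ) :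
    f (Finsupp.linearCombination _ v l) = Finsupp.linearCombination ℂ w
      (l.mapRange (Polynomial.eval g) Polynomial.eval_zero) := by
  rw [Finsupp.linearCombination_apply, Finsupp.linearCombination_apply,
    Finsupp.sum_mapRange_index (by simp), Finsupp.sum, map_sum]
  exact Finset.sum_congr rfl fun i _ => by rw [hf, hv]

/-- Specializing a relation at any `g` shows that its coefficients vanish there, and a complex
polynomial that vanishes everywhere is zero. -/
theorem linearIndependent_proj_smashMonomial_X :
    LinearIndependent (Polynomial ℂ) fun a => QuotBy.proj (Polynomial ℂ)
      (dunklRelations N (Polynomial.X : Polynomial ℂ)) (smashMonomial (Polynomial ℂ) a) := by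
  rw [linearIndependent_iff]
  intro l hl
  ext1 a
  refine Polynomial.funext fun g => ?_
  obtain ⟨f, hf, hm, hρ⟩ := exists_specialization (N := N) g
  have h := map_linearCombination_eval hf
    (map_proj_smashMonomial_specialization hm hρ) l
  rw [hl, map_zero] at h
  have h' := DFunLike.congr_fun
    (linearIndependent_iff.1 (exists_dunklQuot_equiv (N := N) g).2.2 _ h.symm) a
  rw [Finsupp.mapRange_apply] at h'
  rw [h']
  simp

theorem flat_dunklQuot_X : Module.Flat (Polynomial ℂ) (DunklQuot N (Polynomial.X : Polynomial ℂ)) :=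
  have : Module.Free (Polynomial ℂ) (DunklQuot N (Polynomial.X : Polynomial ℂ)) :=
    Module.Free.of_basis (Module.Basis.mk linearIndependent_proj_smashMonomial_X
      (span_proj_smashMonomial Polynomial.X).ge)
  inferInstance

theorem surjective_specialization {g : ℂ}
    {f : DunklQuot N (Polynomial.X : Polynomial ℂ) →+* DunklQuot N g}
    (hf : ∀ c a, f (c • a) = Polynomial.eval g c • f a)
    (hv : ∀ a, f (QuotBy.proj (Polynomial ℂ) (dunklRelations N Polynomial.X)
      (smashMonomial (Polynomial ℂ) a)) =
      QuotBy.proj ℂ (dunklRelations N g) (smashMonomial ℂ a)) : Function.Surjective f := by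
  intro y
  have hy : y ∈ Submodule.span ℂ (Set.range fun a =>
    QuotBy.proj ℂ (dunklRelations N g) (smashMonomial ℂ a)) :=
    (span_proj_smashMonomial g).ge Submodule.mem_top
  induction hy using Submodule.span_induction with
  | mem y hy =>
    obtain ⟨a, rfl⟩ := hy
    exact ⟨_, hv a⟩
  | zero => exact ⟨0, map_zero f⟩
  | add y z _ _ hy hz =>
    obtain ⟨a, rfl⟩ := hy
    obtain ⟨b, rfl⟩ := hz
    exact ⟨a + b, map_add f a b⟩
  | smul c y _ hy =>
    obtain ⟨a, rfl⟩ := hy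
    exact ⟨Polynomial.C c • a, by rw [hf, Polynomial.eval_C]⟩

/-- In the monomial basis specialization evaluates coefficients at `g`; those of an element of the
kernel vanish at `g` and are divisible by `t - g`. -/
theorem specialization_eq_zero_iff {g : ℂ}
    {f : DunklQuot N (Polynomial.X : Polynomial ℂ) →+* DunklQuot N g}
    (hf : ∀ c a, f (c • a) = Polynomial.eval g c • f a)
    (hv : ∀ a, f (QuotBy.proj (Polynomial ℂ) (dunklRelations N Polynomial.X)
      (smashMonomial (Polynomial ℂ) a)) =
      QuotBy.proj ℂ (dunklRelations N g) (smashMonomial ℂ a))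
    (x : DunklQuot N (Polynomial.X : Polynomial ℂ)) :
    f x = 0 ↔ ∃ b, x = (Polynomial.X - Polynomial.C g) • b := by
  constructor
  · intro hx
    obtain ⟨l, rfl⟩ := (Finsupp.mem_span_range_iff_exists_finsupp (R := Polynomial ℂ)).1
      ((span_proj_smashMonomial (N := N) (Polynomial.X : Polynomial ℂ)).ge
        (Submodule.mem_top (x := x)))
    have h := (map_linearCombination_eval hf hv l).symm.trans hx
    have hl := linearIndependent_iff.1 (exists_dunklQuot_equiv (N := N) g).2.2 _ h
    have hdvd : ∀ a, Polynomial.X - Polynomial.C g ∣ l a := fun a => by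
      rw [Polynomial.dvd_iff_isRoot, Polynomial.IsRoot, ← Finsupp.mapRange_apply
        (f := Polynomial.eval g) (hf := Polynomial.eval_zero), hl, Finsupp.zero_apply]
    choose q hq using hdvd
    refine ⟨∑ a ∈ l.support, q a • QuotBy.proj (Polynomial ℂ) (dunklRelations N Polynomial.X)
      (smashMonomial (Polynomial ℂ) a), ?_⟩
    rw [Finsupp.sum, Finset.smul_sum]
    exact Finset.sum_congr rfl fun a _ => by rw [smul_smul, ← hq]
  · rintro ⟨b, rfl⟩
    rw [hf, Polynomial.eval_sub, Polynomial.eval_X, Polynomial.eval_C, sub_self, zero_smul]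

end Family

theorem theorem1 (N : ℕ) :
    (∀ g : ℂ,
      -- the algebra is the quotient of the smash product by the relations
      (∃ Φ : DunklQuot N g ≃ₐ[ℂ] dunklAlgebra N g,
        (∀ i j : Fin N, (Φ (QuotBy.proj ℂ (dunklRelations N g) (smashM ℂ i j)) :
          Module.End ℂ (RatFun N)) = angularOp g i j) ∧
        (∀ σ : Equiv.Perm (Fin N), (Φ (QuotBy.proj ℂ (dunklRelations N g) (smashPerm ℂ σ)) :
          Module.End ℂ (RatFun N)) = permOp σ)) ∧
      -- the non-crossing ordered monomials form a basis
      LinearIndependent ℂ (nonCrossingMonomial (N := N) g) ∧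
      Submodule.span ℂ (Set.range (nonCrossingMonomial (N := N) g)) =
        Subalgebra.toSubmodule (dunklAlgebra N g) ∧
      -- the algebra is a nonhomogeneous quadratic algebra of PBW type
      IsPBWQuadratic (smashGrading N ℂ) (dunklRelations N g)) ∧
    -- the family over the affine line of parameters is flat, and its fibre at `g` is the
    -- algebra with parameter `g`
    Module.Flat (Polynomial ℂ) (DunklQuot N (Polynomial.X : Polynomial ℂ)) ∧
    ∀ g : ℂ, ∃ f : DunklQuot N (Polynomial.X : Polynomial ℂ) →+* DunklQuot N g,
      Function.Surjective f ∧
      (∀ c a, f (c • a) = Polynomial.eval g c • f a) ∧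
      (∀ i j : Fin N,
        f (QuotBy.proj (Polynomial ℂ) (dunklRelations N Polynomial.X)
            (smashM (Polynomial ℂ) i j)) =
          QuotBy.proj ℂ (dunklRelations N g) (smashM ℂ i j)) ∧
      (∀ σ : Equiv.Perm (Fin N),
        f (QuotBy.proj (Polynomial ℂ) (dunklRelations N Polynomial.X)
            (smashPerm (Polynomial ℂ) σ)) =
          QuotBy.proj ℂ (dunklRelations N g) (smashPerm ℂ σ)) ∧
      (∀ a, f a = 0 ↔ ∃ b, a = (Polynomial.X - Polynomial.C g) • b) := by
  refine ⟨fun g => ?_, flat_dunklQuot_X, fun g => ?_⟩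
  · obtain ⟨hΦ, hspan, hind⟩ := exists_dunklQuot_equiv (N := N) g
    exact ⟨hΦ, linearIndependent_nonCrossingMonomial g, hspan, isPBWQuadratic_dunkl hind⟩
  · obtain ⟨f, hf, hm, hρ⟩ := exists_specialization (N := N) g
    have hv := map_proj_smashMonomial_specialization hm hρ
    exact ⟨f, surjective_specialization hf hv, hf, hm, hρ, specialization_eq_zero_iff hf hv⟩
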